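/- Let $\Bbbk$ be an algebraically closed field of characteristic $p>0$ that contains a primitive fourth root of unity $\zeta$ (so $p\neq 2$), and fix a square root $\zeta^{1/2}\in\Bbbk$ of $\zeta$. **Setting.** Let $\mathbf{TL}$ be the Temperley–Lieb category over $\Bbbk$: its objects are the natural numbers, and its morphisms $m\to n$ are the $\Bbbk$-linear combinations of planar tangle diagrams with $m$ lower and $n$ upper end points, modulo isotopy and the relation that a circle equals $-(\zeta+\zeta^{-1})=0$. Composition is vertical stacking (diagrams are read from bottom to top), $\otimes$ is horizontal juxtaposition, and $1_n$ is the identity on $n$ strands. Write $\cup:0\to2$ and $\cap:2\to0$ for the cup and the cap, and $\cup_2:0\to 4$, $\cap_2:4\to 0$ for two nested cups and caps. The braiding is determined by Kauffman's rule: the crossing of two strands in which the strand from bottom left to top right passes over is $\zeta^{1/2}\,1_2+\zeta^{-1/2}\,\cup\cap$. The twist of the object $n$ is the right partial trace over the last $n$ strands of the braiding of $n$ with $n$. For $1\le v\le 2p$ let $\mathrm E_{v-1}\in\mathrm{End}(v-1)$ be the following idempotent. If $v$ is even, $\mathrm E_{v-1}$ is the Jones–Wenzl projector on $v-1$ strands,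 that is, the unique endomorphism that is congruent to $1_{v-1}$ modulo morphisms factoring through fewer strands and is annihilated by capping or cupping any two adjacent strands. If $v\ge3$ is odd, $\mathrm E_{v-1}=\mathrm E_{v-2}\otimes 1_1$; and $\mathrm E_0=1_0$. Let $\mathbb T_\zeta(v-1)$ be the image of $\mathrm E_{v-1}$. For $n\ge0$ let $\mathrm T_\zeta(n)$ be the indecomposable direct summand of the object $n$ (in the Cauchy completion) on which the identity diagram has coefficient $1$, that is, the image of a primitive idempotent congruent to $1_n$ modulo morphisms factoring through fewer strands. Let $\mathbf J$ be the ideal of morphisms that factor through direct sums of objects $\mathrm T_\zeta(w-1)$ with $w\ge 2p$. All identities below are between morphisms of the quotient $\mathbf{TL}/\mathbf J$. Put $\mathrm L^0_{n}=\mathrm E_n(1_{n-2}\otimes\cup\cap)\mathrm E_n$ for even $n\ge2$, and, for odd $v=2a_1+1\ge 3$, $$\mathrm A^0_v=(\mathrm E_{v-1}\otimes1_1)(1_{v-3}\otimes\cup\otimes1_1)\,\mathrm E_{v-2}\,(1_{v-2}\otimes\cap)(\mathrm E_{v-1}\otimes1_1),$$ $$\tilde{\mathrm A}^0_v=(\mathrm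 E_{v-1}\otimes1_1)(1_{v-2}\otimes\cup)\,\mathrm E_{v-2}\,(1_{v-3}\otimes\cap\otimes1_1)(\mathrm E_{v-1}\otimes1_1),$$ $$\mathrm Y^0_v=(\mathrm E_{v-1}\otimes1_1)(1_{v-3}\otimes\cup\otimes1_1)\,\mathrm E_{v-2}\,(1_{v-3}\otimes\cap\otimes1_1)(\mathrm E_{v-1}\otimes1_1),$$ $$\mathrm B^1_v=-\tfrac{a_1-1}{a_1}\,(\mathrm E_{v-2}\otimes1_2)(1_{v-4}\otimes\cup_2)\,\mathrm E_{v-4}\,(1_{v-4}\otimes\cap_2)(\mathrm E_{v-2}\otimes1_2)\qquad(v\ge5).$$ **Statement.** Let $v=2a_1+a_0$ with $1\le a_1\le p-1$ and $a_0\in\{0,1\}$. Let $\beta^2_{v-1,1}$ be the double braiding on $\mathbb T_\zeta(v-1)\otimes\mathbb T_\zeta(1)$, and let $\theta_{v-1}$ be the twist on $\mathbb T_\zeta(v-1)$. 1. If $a_0=0$, then $$\beta^2_{v-1,1}=\zeta^{v-1}\,\mathrm E_v+2\zeta^{v-2}\,\mathrm L^0_v,\qquad \theta_{v-1}=\zeta^{(v-1)(v-3)/2}\,\mathrm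 E_{v-1}=\zeta^{(4a_1^2-8a_1+3)/2}\,\mathrm E_{v-1}=(-1)^{a_1}\zeta^{3/2}\,\mathrm E_{v-1},$$ where $\zeta^{j/2}$ means $(\zeta^{1/2})^j$; the three scalars are equal in $\Bbbk$. 2. If $a_0=1$, then $$\beta^2_{v-1,1}=\zeta^{v-1}\,\mathrm E_v+\zeta^{v-3}\,\mathrm A^0_v+\zeta^{v-3}\,\tilde{\mathrm A}^0_v+2\zeta^{v-2}\,\mathrm Y^0_v+\zeta^{v-1}\,\mathrm B^1_v,\qquad \theta_{v-1}=\mathrm E_{v-1}+2\zeta^{-1}\,\mathrm L^0_{v-1},$$ where the term with $\mathrm E_v$ is omitted if $v=2p-1$, and the term with $\mathrm B^1_v$ is omitted if $v=3$. -/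

import Mathlib

/-! ## Planar tangle diagrams

A planar tangle diagram from `m` to `n` strands in Morse position, read from bottom to top:
a finite sequence of cups (minima) and caps (maxima), stacked on `m` vertical strands.
Strands are counted from the left, starting at `0`. -/

/-- Planar tangle diagrams with `m` lower and `n` upper end points.
`cup i t` puts a cup on top of `t`, with `i` strands to its left; `cap i t` joins the strands
number `i` and `i + 1` at the top of `t` by a cap. -/
inductive Tangle (m : ℕ) : ℕ → Type
  | id : Tangle m m
  | cup {n : ℕ} (i : ℕ) (hi : i ≤ n) (t : Tangle m n) : Tangle m (n + 2)
  | cap {n : ℕ} (i : ℕ) (hi : i ≤ n) (t : Tangle m (n + 2)) : Tangle m n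

namespace Tangle

/-- Vertical stacking: `t` at the bottom, `s` on top of it. -/
def stack {l m : ℕ} (t : Tangle l m) : {n : ℕ} → Tangle m n → Tangle l n
  | _, .id => t
  | _, .cup i hi s => .cup i hi (stack t s)
  | _, .cap i hi s => .cap i hi (stack t s)

/-- `j` vertical strands are added on the left. -/
def addLeft (j : ℕ) {m : ℕ} : {n : ℕ} → Tangle m n → Tangle (j + m) (j + n)
  | _, .id => .id
  | _, .cup (n := n) i hi t => .cup (n := j + n) (j + i) (by omega) (addLeft j t)
  | _, .cap (n := n) i hi t => .cap (n := j + n) (j + i) (by omega) (addLeft j t)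

/-- One vertical strand is added on the right. -/
def addRight {m : ℕ} : {n : ℕ} → Tangle m n → Tangle (m + 1) (n + 1)
  | _, .id => .id
  | _, .cup (n := n) i hi t => .cup (n := n + 1) i (by omega) (addRight t)
  | _, .cap (n := n) i hi t => .cap (n := n + 1) i (by omega) (addRight t)

/-- The elementary planar isotopies: straightening of a zigzag, and exchange of the heights of
two cups or caps that are side by side; they may be applied anywhere in a diagram. -/
inductive Isotopy {m : ℕ} : {n : ℕ} → Tangle m n → Tangle m n → Prop
  | zigzag {n : ℕ} (i : ℕ) (hi : i + 1 ≤ n) (t : Tangle m n) :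
      Isotopy (.cap i (by omega) (.cup (i + 1) hi t)) t
  | zagzig {n : ℕ} (i : ℕ) (hi : i + 1 ≤ n) (t : Tangle m n) :
      Isotopy (.cap (i + 1) hi (.cup i (by omega) t)) t
  | cup_cup {n : ℕ} (i j : ℕ) (hij : i ≤ j) (hj : j ≤ n) (t : Tangle m n) :
      Isotopy (.cup i (by omega) (.cup j hj t)) (.cup (j + 2) (by omega) (.cup i (by omega) t))
  | cap_cap {n : ℕ} (i j : ℕ) (hij : i ≤ j) (hj : j ≤ n) (t : Tangle m (n + 2 + 2)) :
      Isotopy (.cap j hj (.cap i (by omega) t))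
        (.cap i (by omega) (.cap (j + 2) (by omega) t))
  | cup_left_cap {n : ℕ} (i j : ℕ) (hij : i ≤ j) (hj : j ≤ n) (t : Tangle m (n + 2)) :
      Isotopy (.cap (j + 2) (by omega) (.cup i (by omega) t)) (.cup i (by omega) (.cap j hj t))
  | cap_left_cup {n : ℕ} (i j : ℕ) (hij : i ≤ j) (hj : j ≤ n) (t : Tangle m (n + 2)) :
      Isotopy (.cap i (by omega) (.cup (j + 2) (by omega) t)) (.cup j hj (.cap i (by omega) t))
  | cup {n : ℕ} (i : ℕ) (hi : i ≤ n) {s t : Tangle m n} :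
      Isotopy s t → Isotopy (.cup i hi s) (.cup i hi t)
  | cap {n : ℕ} (i : ℕ) (hi : i ≤ n) {s t : Tangle m (n + 2)} :
      Isotopy s t → Isotopy (.cap i hi s) (.cap i hi t)

/-- `LoopRemoval s t`: the diagram `t` is obtained from `s` by removing a circle. -/
inductive LoopRemoval {m : ℕ} : {n : ℕ} → Tangle m n → Tangle m n → Prop
  | loop {n : ℕ} (i : ℕ) (hi : i ≤ n) (t : Tangle m n) :
      LoopRemoval (.cap i hi (.cup i hi t)) t
  | cup {n : ℕ} (i : ℕ) (hi : i ≤ n) {s t : Tangle m n} :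
      LoopRemoval s t → LoopRemoval (.cup i hi s) (.cup i hi t)
  | cap {n : ℕ} (i : ℕ) (hi : i ≤ n) {s t : Tangle m (n + 2)} :
      LoopRemoval s t → LoopRemoval (.cap i hi s) (.cap i hi t)

theorem Isotopy.stack_top {l m : ℕ} (r : Tangle l m) {n : ℕ} {s t : Tangle m n}
    (h : Isotopy s t) : Isotopy (stack r s) (stack r t) := by
  induction h with
  | zigzag i hi t => exact .zigzag i hi _
  | zagzig i hi t => exact .zagzig i hi _
  | cup_cup i j hij hj t => exact .cup_cup i j hij hj _
  | cap_cap i j hij hj t => exact .cap_cap i j hij hj _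
  | cup_left_cap i j hij hj t => exact .cup_left_cap i j hij hj _
  | cap_left_cup i j hij hj t => exact .cap_left_cup i j hij hj _
  | cup i hi _ ih => exact .cup i hi ih
  | cap i hi _ ih => exact .cap i hi ih

theorem Isotopy.stack_bottom {l m : ℕ} {s t : Tangle l m} (h : Isotopy s t) {n : ℕ}
    (r : Tangle m n) : Isotopy (stack s r) (stack t r) := by
  induction r with
  | id => exact h
  | cup i hi _ ih => exact .cup i hi ih
  | cap i hi _ ih => exact .cap i hi ih

theorem Isotopy.left (j : ℕ) {m n : ℕ} {s t : Tangle m n} (h : Isotopy s t) :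
    Isotopy (addLeft j s) (addLeft j t) := by
  induction h with
  | zigzag i hi t => exact .zigzag (n := j + _) (j + i) (by omega) _
  | zagzig i hi t => exact .zagzig (n := j + _) (j + i) (by omega) _
  | cup_cup i i' h h' t => exact .cup_cup (n := j + _) (j + i) (j + i') (by omega) (by omega) _
  | cap_cap i i' h h' t => exact .cap_cap (n := j + _) (j + i) (j + i') (by omega) (by omega) _
  | cup_left_cap i i' h h' t =>
    exact .cup_left_cap (n := j + _) (j + i) (j + i') (by omega) (by omega) _
  | cap_left_cup i i' h h' t =>
    exact .cap_left_cup (n := j + _) (j + i) (j + i') (by omega) (by omega) _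
  | cup i hi _ ih => exact .cup (n := j + _) (j + i) (by omega) ih
  | cap i hi _ ih => exact .cap (n := j + _) (j + i) (by omega) ih

theorem Isotopy.right {m n : ℕ} {s t : Tangle m n} (h : Isotopy s t) :
    Isotopy (addRight s) (addRight t) := by
  induction h with
  | zigzag i hi t => exact .zigzag (n := _ + 1) i (by omega) _
  | zagzig i hi t => exact .zagzig (n := _ + 1) i (by omega) _
  | cup_cup i i' h h' t => exact .cup_cup (n := _ + 1) i i' (by omega) (by omega) _
  | cap_cap i i' h h' t => exact .cap_cap (n := _ + 1) i i' (by omega) (by omega) _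
  | cup_left_cap i i' h h' t => exact .cup_left_cap (n := _ + 1) i i' (by omega) (by omega) _
  | cap_left_cup i i' h h' t => exact .cap_left_cup (n := _ + 1) i i' (by omega) (by omega) _
  | cup i hi _ ih => exact .cup (n := _ + 1) i (by omega) ih
  | cap i hi _ ih => exact .cap (n := _ + 1) i (by omega) ih

theorem LoopRemoval.stack_top {l m : ℕ} (r : Tangle l m) {n : ℕ} {s t : Tangle m n}
    (h : LoopRemoval s t) : LoopRemoval (stack r s) (stack r t) := by
  induction h with
  | loop i hi t => exact .loop i hi _
  | cup i hi _ ih => exact .cup i hi ih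
  | cap i hi _ ih => exact .cap i hi ih

theorem LoopRemoval.stack_bottom {l m : ℕ} {s t : Tangle l m} (h : LoopRemoval s t) {n : ℕ}
    (r : Tangle m n) : LoopRemoval (stack s r) (stack t r) := by
  induction r with
  | id => exact h
  | cup i hi _ ih => exact .cup i hi ih
  | cap i hi _ ih => exact .cap i hi ih

theorem LoopRemoval.left (j : ℕ) {m n : ℕ} {s t : Tangle m n} (h : LoopRemoval s t) :
    LoopRemoval (addLeft j s) (addLeft j t) := by
  induction h with
  | loop i hi t => exact .loop (n := j + _) (j + i) (by omega) _
  | cup i hi _ ih => exact .cup (n := j + _) (j + i) (by omega) ih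
  | cap i hi _ ih => exact .cap (n := j + _) (j + i) (by omega) ih

theorem LoopRemoval.right {m n : ℕ} {s t : Tangle m n} (h : LoopRemoval s t) :
    LoopRemoval (addRight s) (addRight t) := by
  induction h with
  | loop i hi t => exact .loop (n := _ + 1) i (by omega) _
  | cup i hi _ ih => exact .cup (n := _ + 1) i (by omega) ih
  | cap i hi _ ih => exact .cap (n := _ + 1) i (by omega) ih

end Tangle

/-! ## The Temperley-Lieb category -/

noncomputable section

/-- The linear relations between diagrams: isotopic diagrams are equal, and a circle may be
removed at the price of the factor `δ`. -/
def tlRelations {k : Type*} [Field k] (δ : k) (m n : ℕ) : Submodule k (Tangle m n →₀ k) :=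
  Submodule.span k
    ({x | ∃ s t : Tangle m n, s.Isotopy t ∧ x = Finsupp.single s 1 - Finsupp.single t 1} ∪
      {x | ∃ s t : Tangle m n, s.LoopRemoval t ∧
        x = Finsupp.single s 1 - δ • Finsupp.single t 1})

/-- The space of morphisms `m ⟶ n` of the Temperley-Lieb category with loop value `δ`. -/
abbrev TL {k : Type*} [Field k] (δ : k) (m n : ℕ) : Type _ :=
  (Tangle m n →₀ k) ⧸ tlRelations δ m n

namespace TL

variable {k : Type*} [Field k] {δ : k}

/-- The morphism given by a diagram. -/
def ofTangle (δ : k) {m n : ℕ} (t : Tangle m n) : TL δ m n :=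
  (tlRelations δ m n).mkQ (Finsupp.single t 1)

theorem ofTangle_isotopy {m n : ℕ} {s t : Tangle m n} (h : s.Isotopy t) :
    ofTangle δ s = ofTangle δ t := by
  rw [ofTangle, ofTangle, ← sub_eq_zero, ← map_sub]
  exact (Submodule.Quotient.mk_eq_zero _).2 (Submodule.subset_span (Or.inl ⟨s, t, h, rfl⟩))

theorem ofTangle_loop {m n : ℕ} {s t : Tangle m n} (h : s.LoopRemoval t) :
    ofTangle δ s = δ • ofTangle δ t := by
  rw [ofTangle, ofTangle, ← sub_eq_zero, ← map_smul, ← map_sub]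
  exact (Submodule.Quotient.mk_eq_zero _).2 (Submodule.subset_span (Or.inr ⟨s, t, h, rfl⟩))

/-- A function on diagrams that respects isotopy and removal of circles extends linearly to
the morphisms of the Temperley-Lieb category. -/
def lift {V : Type*} [AddCommGroup V] [Module k V] {m n : ℕ} (F : Tangle m n → V)
    (hiso : ∀ s t, s.Isotopy t → F s = F t) (hloop : ∀ s t, s.LoopRemoval t → F s = δ • F t) :
    TL δ m n →ₗ[k] V :=
  (tlRelations δ m n).liftQ (Finsupp.linearCombination k F) (by
    rw [tlRelations, Submodule.span_le]
    rintro x (⟨s, t, h, rfl⟩ | ⟨s, t, h, rfl⟩)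
    · simp [hiso s t h]
    · simp [hloop s t h])

theorem lift_ofTangle {V : Type*} [AddCommGroup V] [Module k V] {m n : ℕ} (F : Tangle m n → V)
    (hiso : ∀ s t, s.Isotopy t → F s = F t) (hloop : ∀ s t, s.LoopRemoval t → F s = δ • F t)
    (t : Tangle m n) : lift (δ := δ) F hiso hloop (ofTangle δ t) = F t := by
  simp [lift, ofTangle]

theorem hom_ext {V : Type*} [AddCommGroup V] [Module k V] {m n : ℕ}
    {f g : TL δ m n →ₗ[k] V} (h : ∀ t, f (ofTangle δ t) = g (ofTangle δ t)) : f = g := by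
  refine Submodule.linearMap_qext _ (Finsupp.lhom_ext fun t c => ?_)
  have e : (tlRelations δ m n).mkQ (Finsupp.single t c) = c • ofTangle δ t := by
    rw [ofTangle, ← map_smul, Finsupp.smul_single, smul_eq_mul, mul_one]
  rw [LinearMap.comp_apply, LinearMap.comp_apply, e, map_smul, map_smul, h t]

/-- Composition of morphisms as a bilinear map, `g` stacked on top of `f`. -/
def compₗ {l m n : ℕ} : TL δ m n →ₗ[k] TL δ l m →ₗ[k] TL δ l n :=
  lift (fun s => lift (fun t => ofTangle δ (t.stack s))
      (fun _ _ h => ofTangle_isotopy (h.stack_bottom s))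
      (fun _ _ h => ofTangle_loop (h.stack_bottom s)))
    (fun s s' h => hom_ext fun t => by
      simpa only [lift_ofTangle] using ofTangle_isotopy (h.stack_top t))
    (fun s s' h => hom_ext fun t => by
      simpa only [lift_ofTangle, LinearMap.smul_apply] using ofTangle_loop (h.stack_top t))

/-- The composition `g ∘ f`: the diagram of `g` on top of the diagram of `f`. -/
def comp {l m n : ℕ} (g : TL δ m n) (f : TL δ l m) : TL δ l n := compₗ g f

infixr:80 " ⊚ " => TL.comp

theorem comp_ofTangle {l m n : ℕ} (s : Tangle m n) (t : Tangle l m) :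
    ofTangle δ s ⊚ ofTangle δ t = ofTangle δ (t.stack s) := by
  simp only [comp, compₗ, lift_ofTangle]

/-- The identity of the object `n`. -/
def one (δ : k) (n : ℕ) : TL δ n n := ofTangle δ .id

/-- The tensor product `id_j ⊗ f`. -/
def leftId (j : ℕ) {m n : ℕ} : TL δ m n →ₗ[k] TL δ (j + m) (j + n) :=
  lift (fun t => ofTangle δ (t.addLeft j)) (fun _ _ h => ofTangle_isotopy (h.left j))
    (fun _ _ h => ofTangle_loop (h.left j))

/-- The tensor product `f ⊗ id_1`. -/
def rightId {m n : ℕ} : TL δ m n →ₗ[k] TL δ (m + 1) (n + 1) :=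
  lift (fun t => ofTangle δ t.addRight) (fun _ _ h => ofTangle_isotopy h.right)
    (fun _ _ h => ofTangle_loop h.right)

/-- The tensor product `f ⊗ id_j`. -/
def rightIds {m n : ℕ} (f : TL δ m n) : (j : ℕ) → TL δ (m + j) (n + j)
  | 0 => f
  | j + 1 => rightId (rightIds f j)

/-- The tensor product `f ⊗ g`. -/
def tensor {m n m' n' : ℕ} (f : TL δ m n) (g : TL δ m' n') : TL δ (m + m') (n + n') :=
  leftId n g ⊚ rightIds f m'

/-- The cup with `i` strands to its left and `n - i` strands to its right. -/
def cupAt (δ : k) (n i : ℕ) (hi : i ≤ n) : TL δ n (n + 2) := ofTangle δ (.cup i hi .id)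

/-- The cap with `i` strands to its left and `n - i` strands to its right. -/
def capAt (δ : k) (n i : ℕ) (hi : i ≤ n) : TL δ (n + 2) n := ofTangle δ (.cap i hi .id)

/-- The right partial trace: the last strand is closed up. -/
def partialTrace {m n : ℕ} (f : TL δ (m + 1) (n + 1)) : TL δ m n :=
  capAt δ n n le_rfl ⊚ rightId f ⊚ cupAt δ m m le_rfl

/-- The last `j` strands are closed up on the right. -/
def partialTraces {m n : ℕ} : (j : ℕ) → TL δ (m + j) (n + j) → TL δ m n
  | 0, f => f
  | j + 1, f => partialTraces j (partialTrace f)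

/-! ### Braiding and twist

Here `s` is the chosen square root of `ζ`, and the loop value is `-(ζ + ζ⁻¹)`. -/

/-- The loop value `-(ζ + ζ⁻¹)`, where `ζ = s ^ 2`. -/
def loopValue (s : k) : k := -(s ^ 2 + (s ^ 2)⁻¹)

/-- The crossing, on `N` strands, of the strands `i` and `i + 1`, the one that starts on the left
passing over; it is resolved by the Kauffman bracket rule.
(It is set to `0` when there are no such strands.) -/
def crossing (s : k) : (N i : ℕ) → TL (loopValue s) N N
  | n + 2, i =>
    if hi : i ≤ n then
      s • one (loopValue s) (n + 2) + s⁻¹ • (cupAt (loopValue s) n i hi ⊚ capAt (loopValue s) n i hi)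
    else 0
  | _, _ => 0

/-- The strand in position `j + m` moves to position `j`, under the `m` strands in between. -/
def passUnder (s : k) (N j : ℕ) : (m : ℕ) → TL (loopValue s) N N
  | 0 => one _ N
  | m + 1 => passUnder s N j m ⊚ crossing s N (j + m)

/-- The braiding of the first `m` strands with the following `n` strands, among `N` strands. -/
def braiding (s : k) (N m : ℕ) : (n : ℕ) → TL (loopValue s) N N
  | 0 => one _ N
  | n + 1 => passUnder s N n m ⊚ braiding s N m n

/-- The double braiding of the objects `m` and `n`. -/
def doubleBraiding (s : k) (m n : ℕ) : TL (loopValue s) (m + n) (m + n) :=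
  braiding s (m + n) n m ⊚ braiding s (m + n) m n

/-- The double braiding of the summands of `m` and `n` given by idempotents `e` and `f`. -/
def doubleBraidingOn {s : k} {m n : ℕ} (e : TL (loopValue s) m m) (f : TL (loopValue s) n n) :
    TL (loopValue s) (m + n) (m + n) :=
  doubleBraiding s m n ⊚ tensor e f

/-- The twist of the object `n`: the positive curl on `n` parallel strands. -/
def twist (s : k) (n : ℕ) : TL (loopValue s) n n := partialTraces n (braiding s (n + n) n n)

/-- The twist of the summand of `n` given by an idempotent `e`. -/
def twistOn {s : k} {n : ℕ} (e : TL (loopValue s) n n) : TL (loopValue s) n n := twist s n ⊚ e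

/-! ### The distinguished idempotents -/

/-- The endomorphisms of `n` that factor through fewer than `n` strands (linear combinations of
such). -/
def lower (δ : k) (n : ℕ) : Submodule k (TL δ n n) :=
  Submodule.span k {x | ∃ m < n, ∃ (g : TL δ m n) (f : TL δ n m), x = g ⊚ f}

/-- `e` is the Jones-Wenzl projector on `n` strands: its identity coefficient is `1`, and it is
annihilated by capping and cupping any two adjacent strands. -/
def IsJonesWenzl : {n : ℕ} → TL δ n n → Prop
  | 0, e => e = one δ 0
  | 1, e => e = one δ 1
  | n + 2, e => one δ (n + 2) - e ∈ lower δ (n + 2) ∧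
      ∀ (i : ℕ) (hi : i ≤ n), capAt δ n i hi ⊚ e = 0 ∧ e ⊚ cupAt δ n i hi = 0

open Classical in
/-- The Jones-Wenzl projector on `n` strands; it is unique when it exists. -/
def jonesWenzl (δ : k) (n : ℕ) : TL δ n n :=
  if h : ∃ e : TL δ n n, IsJonesWenzl e then h.choose else 0

/-- The idempotents `E_{v-1}` on `v - 1 = n` strands, for `ζ` a primitive fourth root of unity
in characteristic `p` and `1 ≤ v ≤ 2 p`. If `v = 2 a` is even, `E_{v-1}` is the Jones-Wenzl
projector. If `v = 2 a + 1` with `a ≥ 1`, it is the sum of the two rational projectors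
`JW_{2a}` and `-([2a-1]/[2a]) (JW_{2a-1} ⊗ 1) ∪∩ (JW_{2a-1} ⊗ 1)`; by the recursion
for the Jones-Wenzl projectors, this sum is `JW_{2a-1} ⊗ 1`. -/
def E (δ : k) : (n : ℕ) → TL δ n n
  | 0 => one δ 0
  | n + 1 => if Even n then jonesWenzl δ (n + 1) else rightId (jonesWenzl δ n)

/-! ### The tensor ideal and the quotient -/

/-- The idempotent `e` on `n` strands has image the indecomposable tilting module `T(n)`:
it is primitive and its identity coefficient is `1`. -/
def IsTilting {n : ℕ} (e : TL δ n n) : Prop :=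
  e ⊚ e = e ∧ one δ n - e ∈ lower δ n ∧
    ∀ f : TL δ n n, f ⊚ f = f → e ⊚ f = f → f ⊚ e = f → f = 0 ∨ f = e

/-- The morphisms `m ⟶ n` that factor through a direct sum of indecomposable tilting modules
`T(w - 1)` with `w ≥ d`. -/
def idealJ (δ : k) (d m n : ℕ) : Submodule k (TL δ m n) :=
  Submodule.span k {x | ∃ (w : ℕ) (e : TL δ w w) (g : TL δ w n) (f : TL δ m w),
    d ≤ w + 1 ∧ IsTilting e ∧ x = g ⊚ e ⊚ f}

/-- The class of a morphism in the quotient of the Temperley-Lieb category by the tensor ideal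
of the tilting modules `T(w - 1)` with `w ≥ 2 p`. -/
def toVer (p : ℕ) {m n : ℕ} : TL δ m n →ₗ[k] TL δ m n ⧸ idealJ δ (2 * p) m n :=
  (idealJ δ (2 * p) m n).mkQ

/-! ### The basis morphisms -/

/-- `L⁰_n = E_n ∘ (id_{n-2} ⊗ ∪∩) ∘ E_n`, for `n ≥ 2`. -/
def L (δ : k) : (n : ℕ) → TL δ n n
  | n + 2 => E δ (n + 2) ⊚ cupAt δ n n le_rfl ⊚ capAt δ n n le_rfl ⊚ E δ (n + 2)
  | _ => 0

/-- `A⁰_v`, for `v ≥ 3`. -/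
def A (δ : k) : (v : ℕ) → TL δ v v
  | m + 3 => rightId (E δ (m + 2)) ⊚ cupAt δ (m + 1) m (by omega) ⊚ E δ (m + 1) ⊚
      capAt δ (m + 1) (m + 1) le_rfl ⊚ rightId (E δ (m + 2))
  | _ => 0

/-- `Ã⁰_v`, the up-down mirror of `A⁰_v`. -/
def Atilde (δ : k) : (v : ℕ) → TL δ v v
  | m + 3 => rightId (E δ (m + 2)) ⊚ cupAt δ (m + 1) (m + 1) le_rfl ⊚ E δ (m + 1) ⊚
      capAt δ (m + 1) m (by omega) ⊚ rightId (E δ (m + 2))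
  | _ => 0

/-- `Y⁰_v`, for `v ≥ 3`. -/
def Y (δ : k) : (v : ℕ) → TL δ v v
  | m + 3 => rightId (E δ (m + 2)) ⊚ cupAt δ (m + 1) m (by omega) ⊚ E δ (m + 1) ⊚
      capAt δ (m + 1) m (by omega) ⊚ rightId (E δ (m + 2))
  | _ => 0

/-- `B¹_v`, for `v = 2 a + 1 ≥ 5`:  `-((a - 1) / a)` times
`(E_{v-2} ⊗ id_2) ∘ (id_{v-4} ⊗ ∪∪) ∘ E_{v-4} ∘ (id_{v-4} ⊗ ∩∩) ∘ (E_{v-2} ⊗ id_2)`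
with nested double cups and caps. -/
def B (δ : k) : (v : ℕ) → TL δ v v
  | m + 4 => (-((((m + 4) / 2 : ℕ) : k) - 1) / (((m + 4) / 2 : ℕ) : k)) •
      (rightIds (E δ (m + 2)) 2 ⊚ cupAt δ (m + 2) (m + 1) (by omega) ⊚ cupAt δ m m le_rfl ⊚
        E δ m ⊚ capAt δ m m le_rfl ⊚ capAt δ (m + 2) (m + 1) (by omega) ⊚
        rightIds (E δ (m + 2)) 2)
  | _ => 0

end TL

end

/-! ## The Temperley-Lieb relations with loop value zero in an associative algebra -/

/-! Write `f_b` for the Jones-Wenzl projector on `2b+1` strands, put `b = a₁ - 1`, and let `U_i` be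
the standard generators, so that `U_i² = 0` because the loop value vanishes. The usual one-strand
recursion for these projectors would pass through an even number of strands and divide by a quantum
number that is zero. `oddProjector` therefore advances two strands at a time. With `u = U_{2b}`, `v
= U_{2b+1}`, `q = U_{2b-1}`, `f_{b+1} = f_b + (b/(b+1)) f_b u q v u f_b - f_b u v f_b - f_b v u
f_b`, and the only denominators are the integers `1, …, b+1`, invertible in `k` as long as they are
below `p`. That generators annihilate it is a computation in any algebra satisfying the
Temperley-Lieb relations (`projector_step`, `gen_mul_oddProjector`); uniqueness of Jones-Wenzl
projectors, which rests on the normal form "caps below cups", identifies it with `E` (`E_odd`,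
`E_even`). Sliding projectors around cups and caps then writes `L`, `A`, `Atilde`, `Y`, `B` as `f_b
w f_b` with short words `w` in `u`, `v`, `q`.

The double braiding with one strand is the Jucys-Murphy braid `J_m`, which satisfies `J_{m+1} = σ_m
J_m σ_m` with `σ_m² = ζ + 2U_m`. Compressing it between elements killed by the lower generators
gives a recursion for the coefficient of `U_m`; since `ζ² = -1`, that coefficient is `2ζ^m` for even
`m` and zero for odd `m` (`compress_jucysMurphy`). This is the formula for even `v`. For odd `v` the
projector stops one strand earlier, so one further conjugation by a crossing is expanded
(`compress_jucysMurphy_succ`), and the recursion for `f_{b+1}`, which says `f_b = E_v + A + Ã + B`,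
rearranges the result.

The twist on `n` strands is `s^{-n}` times the full twist, each partial trace of a crossing
contributing `s^{-1}` (`twist_eq`). On a Jones-Wenzl projector every crossing acts by `s`; with one
extra strand the full twist splits off a Jucys-Murphy factor (`fullTwist_eq`), which is compressed
as before.

All the identities already hold before passing to the quotient. The ideal matters only for `v = 2p -
1`, where `E_v` is the Jones-Wenzl projector on `2p - 1` strands; it is primitive and hence lies in
the ideal (`toVer_E_eq_zero`). -/

/-- The first `M` terms of the sequence `U` satisfy the Temperley-Lieb relations with loop
value `0`. -/
structure TLRelations {R : Type*} [Ring R] (U : ℕ → R) (M : ℕ) : Prop where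
  sq : ∀ i, i < M → U i * U i = 0
  up : ∀ i, i + 1 < M → U i * U (i + 1) * U i = U i
  down : ∀ i, i + 1 < M → U (i + 1) * U i * U (i + 1) = U (i + 1)
  far : ∀ i j, i + 1 < j → j < M → U i * U j = U j * U i

namespace TLRelations

variable {R : Type*} [Ring R] {U : ℕ → R} {M : ℕ}

/-- The relations are invariant under reversing words, so statements about left multiplication yield
their mirror images by passing to the opposite ring. -/
theorem op (h : TLRelations U M) : TLRelations (fun i => MulOpposite.op (U i)) M where
  sq i hi := by rw [← MulOpposite.op_mul, h.sq i hi, MulOpposite.op_zero]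
  up i hi := by rw [← MulOpposite.op_mul, ← MulOpposite.op_mul, ← mul_assoc, h.up i hi]
  down i hi := by rw [← MulOpposite.op_mul, ← MulOpposite.op_mul, ← mul_assoc, h.down i hi]
  far i j hij hj := by rw [← MulOpposite.op_mul, ← MulOpposite.op_mul, h.far i j hij hj]

end TLRelations

/-! ### Jones-Wenzl projectors on an odd number of strands -/

section OddProjector

variable {k R : Type*} [Field k] [Ring R] [Algebra k R]

variable (k) in
/-- The Jones-Wenzl projector on `2 b + 1` strands, as a polynomial in the generators. -/
noncomputable def oddProjector (U : ℕ → R) : ℕ → R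
  | 0 => 1
  -- For `b = 0` the truncated index `2 * b - 1` is `0`, which is harmless because the coefficient
  -- `b / (b + 1)` vanishes.
  | b + 1 => oddProjector U b
      + ((b : k) / ((b : k) + 1)) • (oddProjector U b *
        (U (2 * b) * U (2 * b - 1) * U (2 * b + 1) * U (2 * b)) * oddProjector U b)
      - oddProjector U b * (U (2 * b) * U (2 * b + 1)) * oddProjector U b
      - oddProjector U b * (U (2 * b + 1) * U (2 * b)) * oddProjector U b

theorem oddProjector_commute {U : ℕ → R} {x : R} (b : ℕ)
    (h : ∀ i < 2 * b, Commute (U i) x) : Commute (oddProjector k U b) x := by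
  induction b with
  | zero => exact Commute.one_left x
  | succ b ih =>
    have hf : Commute (oddProjector k U b) x := ih fun i hi => h i (by omega)
    have h0 := h (2 * b) (by omega)
    have h1 := h (2 * b + 1) (by omega)
    have h2 := h (2 * b - 1) (by omega)
    exact (((hf.add_left (((hf.mul_left (((h0.mul_left h2).mul_left h1).mul_left h0)).mul_left
      hf).smul_left _)).sub_left ((hf.mul_left (h0.mul_left h1)).mul_left hf))).sub_left
      ((hf.mul_left (h1.mul_left h0)).mul_left hf)

/-- The constant term of the polynomial is `1` and every other term contains a generator of index
below `2 * b`. Idempotence and absorption of smaller projectors are special cases. -/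
theorem oddProjector_mul_of_kill {U : ℕ → R} {x : R} (b : ℕ)
    (h : ∀ i < 2 * b, U i * x = 0) : oddProjector k U b * x = x := by
  induction b with
  | zero => exact one_mul x
  | succ b ih =>
    have hf : oddProjector k U b * x = x := ih fun i hi => h i (by omega)
    have h0 := h (2 * b) (by omega)
    have h1 := h (2 * b + 1) (by omega)
    simp [oddProjector, add_mul, sub_mul, mul_assoc, hf, h0, h1]

/-- Stated for a linear map with multiplicativity as hypotheses so as to apply to `rightId`, which
is bundled only as a linear map. -/
theorem map_oddProjector {S : Type*} [Ring S] [Algebra k S] (φ : R →ₗ[k] S)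
    (hone : φ 1 = 1) (hmul : ∀ x y, φ (x * y) = φ x * φ y) {U : ℕ → R} {V : ℕ → S} (b : ℕ)
    (h : ∀ i < 2 * b, φ (U i) = V i) : φ (oddProjector k U b) = oddProjector k V b := by
  induction b with
  | zero => exact hone
  | succ b ih =>
    have hf := ih fun i hi => h i (by omega)
    have h0 := h (2 * b) (by omega)
    have h1 := h (2 * b + 1) (by omega)
    have h2 := h (2 * b - 1) (by omega)
    simp only [oddProjector, map_add, map_sub, map_smul, hmul, hf, h0, h1, h2]

/-- Reversal exchanges the words `uv` and `vu`, and fixes `uqvu` because `q` and `v` commute. For `b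
= 0` they need not commute, but then that term has coefficient zero. -/
theorem oddProjector_op {U : ℕ → R} {M : ℕ} (hU : TLRelations U M) (b : ℕ) (hb : 2 * b ≤ M) :
    oddProjector k (fun i => MulOpposite.op (U i)) b = MulOpposite.op (oddProjector k U b) := by
  induction b with
  | zero => rfl
  | succ b ih =>
    rw [oddProjector, ih (by omega), oddProjector]
    simp only [MulOpposite.op_add, MulOpposite.op_sub, MulOpposite.op_smul, MulOpposite.op_mul,
      mul_assoc]
    rcases Nat.eq_zero_or_pos b with rfl | hpos
    · simp only [Nat.cast_zero, zero_div, zero_smul, add_zero]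
      abel
    · have e : MulOpposite.op (U (2 * b - 1)) * MulOpposite.op (U (2 * b + 1)) =
          MulOpposite.op (U (2 * b + 1)) * MulOpposite.op (U (2 * b - 1)) :=
        hU.op.far _ _ (by omega) (by omega)
      rw [← mul_assoc (MulOpposite.op (U (2 * b - 1))), e, mul_assoc]
      abel

/-- Inductive step for the annihilation of `oddProjector` by the last generator but one. -/
theorem projector_step {f g q r t u v : R} {x y : k}
    (hf : f = g + x • (g * (r * q * t * r) * g) - g * (r * t) * g - g * (t * r) * g)
    (hx : x = 0 ∨ (r * q * r = r ∧ q * u = u * q)) (hxy : y * (x - 2) = -1)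
    (hgu : g * u = u * g) (hgt : g * t = t * g) (hgv : g * v = v * g) (hgf : g * f = f)
    (hfv : f * v = v * f) (hrf : r * f = 0) (huu : u * u = 0) (hru : r * u = u * r)
    (hrv : r * v = v * r) (htv : t * v = v * t)
    (hutu : u * t * u = u) (huvu : u * v * u = u) :
    u * (f + y • (f * (u * t * v * u) * f) - f * (u * v) * f - f * (v * u) * f) = 0 ∧
      u * v * f * u * f = u * f - g * r * (u * t * v * u) * f := by
  have hgu' (z : R) : u * (g * z) = g * (u * z) := by rw [← mul_assoc, ← hgu, mul_assoc]
  have hgt' (z : R) : t * (g * z) = g * (t * z) := by rw [← mul_assoc, ← hgt, mul_assoc]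
  have hgv' (z : R) : v * (g * z) = g * (v * z) := by rw [← mul_assoc, ← hgv, mul_assoc]
  have hru' (z : R) : u * (r * z) = r * (u * z) := by rw [← mul_assoc, ← hru, mul_assoc]
  have hrv' (z : R) : v * (r * z) = r * (v * z) := by rw [← mul_assoc, ← hrv, mul_assoc]
  have htv' (z : R) : v * (t * z) = t * (v * z) := by rw [← mul_assoc, ← htv, mul_assoc]
  have hfv' (z : R) : f * (v * z) = v * (f * z) := by rw [← mul_assoc, hfv, mul_assoc]
  have hutu' (z : R) : u * (t * (u * z)) = u * z := by rw [← mul_assoc, ← mul_assoc, hutu]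
  have huvu' (z : R) : u * (v * (u * z)) = u * z := by rw [← mul_assoc, ← mul_assoc, huvu]
  have hguf : g * (u * f) = u * f := by rw [← mul_assoc, hgu, mul_assoc, hgf]
  have hruf : r * (u * f) = 0 := by rw [← mul_assoc, hru, mul_assoc, hrf, mul_zero]
  -- Algebraic form of a partial trace of `f`: the leading term dies because `u² = 0`, and the other
  -- three each give `g r g u`, with coefficients `x`, `-1`, `-1`.
  have hufu : u * f * u = (x - 2) • (g * r * g * u) := by
    have e1 : u * g * u = 0 := by rw [← hgu, mul_assoc, huu, mul_zero]
    have e2 : x • (u * (g * (r * q * t * r) * g) * u) = x • (g * r * g * u) := by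
      rcases hx with rfl | ⟨hrqr, hqu⟩
      · simp
      · have hqu' (z : R) : u * (q * z) = q * (u * z) := by rw [← mul_assoc, ← hqu, mul_assoc]
        have hrqr' (z : R) : r * (q * (r * z)) = r * z := by rw [← mul_assoc, ← mul_assoc, hrqr]
        simp only [mul_assoc, hgu', hru', hqu', hgu]
        rw [← hru', hutu', hru', hrqr']
    have e3 : u * (g * (r * t) * g) * u = g * r * g * u := by
      simp only [mul_assoc, hgu, hgu', hru', hutu']
    have e4 : u * (g * (t * r) * g) * u = g * r * g * u := by
      simp only [mul_assoc, hgu, hgu', ← hru', hutu']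
    rw [hf, mul_sub, mul_sub, mul_add, sub_mul, sub_mul, add_mul, e1, e3, e4, mul_smul_comm,
      smul_mul_assoc, e2]
    module
  have huvf : u * v * f * u * f = u * f - g * r * (u * t * v * u) * f := by
    have e1 : u * v * g * u * f = u * f := by
      simp only [mul_assoc, hguf, huvu']
    have e2 : u * v * (g * (r * q * t * r) * g) * u * f = 0 := by
      simp only [mul_assoc, hguf, hruf, mul_zero]
    have e3 : u * v * (g * (r * t) * g) * u * f = g * r * (u * t * v * u) * f := by
      simp only [mul_assoc, hguf]
      simp only [hgu', hgv', hru', hrv', htv']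
    have e4 : u * v * (g * (t * r) * g) * u * f = 0 := by
      simp only [mul_assoc, hguf, hruf, mul_zero]
    have : u * v * f * u * f = u * v * (g + x • (g * (r * q * t * r) * g) - g * (r * t) * g
        - g * (t * r) * g) * u * f := by rw [← hf]
    rw [this]
    simp only [mul_sub, mul_add, sub_mul, add_mul, mul_smul_comm, smul_mul_assoc, e1, e2, e3, e4,
      smul_zero, add_zero, sub_zero]
  refine ⟨?_, huvf⟩
  have e1 : u * (f * (u * t * v * u) * f) = (x - 2) • (g * r * (u * t * v * u) * f) := by
    have : u * (f * (u * t * v * u) * f) = u * f * u * (t * v * u * f) := by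
      simp only [mul_assoc]
    rw [this, hufu, smul_mul_assoc]
    simp only [mul_assoc]
    rw [← hgu', ← hgt', ← hgv', hguf]
  have e2 : u * (f * (u * v) * f) = 0 := by
    have : u * (f * (u * v) * f) = u * f * u * (v * f) := by
      simp only [mul_assoc]
    rw [this, hufu, smul_mul_assoc]
    have : g * r * g * u * (v * f) = g * (u * (v * (r * f))) := by
      simp only [mul_assoc]
      rw [← hgu', ← hgv', hgf, ← hru', ← hrv']
    rw [this, hrf, mul_zero, mul_zero, mul_zero, smul_zero]
  have e3 : u * (f * (v * u) * f) = u * f - g * r * (u * t * v * u) * f := by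
    rw [← huvf]
    simp only [mul_assoc, hfv']
  -- The condition `y (x - 2) = -1` makes the term with coefficient `y` cancel the correction left
  -- over from `f v u f`.
  rw [mul_sub, mul_sub, mul_add, mul_smul_comm, e1, e2, e3, smul_smul, hxy]
  module

theorem oddProjector_step {U : ℕ → R} {M : ℕ} (hU : TLRelations U M) (d : ℕ)
    (hM : 2 * d + 4 ≤ M) (hd : ((d + 1 : ℕ) : k) ≠ 0) (hd' : ((d + 2 : ℕ) : k) ≠ 0)
    (hkill : ∀ i < 2 * (d + 1), U i * oddProjector k U (d + 1) = 0) :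
    U (2 * d + 2) * oddProjector k U (d + 1 + 1) = 0 ∧
    U (2 * d + 2) * U (2 * d + 3) * oddProjector k U (d + 1) * U (2 * d + 2) *
      oddProjector k U (d + 1) = U (2 * d + 2) * oddProjector k U (d + 1) -
        oddProjector k U d * U (2 * d) * (U (2 * d + 2) * U (2 * d + 1) * U (2 * d + 3) *
          U (2 * d + 2)) * oddProjector k U (d + 1) := by
  push_cast at hd hd'
  have hcomm (j : ℕ) (hj : 2 * d < j) (hj' : j < M) :
      oddProjector k U d * U j = U j * oddProjector k U d :=
    oddProjector_commute d fun i hi => hU.far i j (by omega) hj'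
  refine projector_step (q := U (2 * d - 1)) (t := U (2 * d + 1)) (x := (d : k) / (d + 1))
    (by rw [oddProjector]) ?_ ?_
    (hcomm _ (by omega) (by omega)) (hcomm _ (by omega) (by omega))
    (hcomm _ (by omega) (by omega)) (oddProjector_mul_of_kill d fun i hi => hkill i (by omega))
    (oddProjector_commute _ fun i hi => hU.far i _ (by omega) (by omega)) (hkill _ (by omega))
    (hU.sq _ (by omega)) (hU.far _ _ (by omega) (by omega)) (hU.far _ _ (by omega) (by omega))
    (hU.far _ _ (by omega) (by omega)) (hU.down _ (by omega)) (hU.up _ (by omega))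
  · rcases Nat.eq_zero_or_pos d with rfl | hpos
    · left; simp
    · right
      obtain ⟨d, rfl⟩ : ∃ d', d = d' + 1 := ⟨d - 1, by omega⟩
      exact ⟨hU.down (2 * d + 1) (by omega), hU.far _ _ (by omega) (by omega)⟩
  -- Here `x = d/(d+1)` and `y = (d+1)/(d+2)`, so `x - 2 = -(d+2)/(d+1)`: this is what forces the
  -- coefficients of the recursion.
  · push_cast
    have : (d : k) + 1 + 1 ≠ 0 := by rwa [add_assoc, one_add_one_eq_two]
    field_simp
    ring

/-- Only the last two generators need work: `U (2 * b)` is `projector_step`, and for `U (2 * b + 1)`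
the relation `v u v = v` makes the term `f u v f` cancel the leading one. The ring is generalized in
the induction because the last case uses the hypothesis in the opposite ring. -/
theorem gen_mul_oddProjector {U : ℕ → R} {M : ℕ} (hU : TLRelations U M) (b : ℕ) (hb : 2 * b ≤ M)
    (hk : ∀ j, 1 ≤ j → j ≤ b → (j : k) ≠ 0) (i : ℕ) (hi : i < 2 * b) :
    U i * oddProjector k U b = 0 := by
  induction b generalizing R i with
  | zero => omega
  | succ b ih =>
    have ih' := ih hU (by omega) fun j h h' => hk j h (by omega)
    have hff : oddProjector k U b * oddProjector k U b = oddProjector k U b :=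
      oddProjector_mul_of_kill b ih'
    obtain hlt | rfl | rfl : i < 2 * b ∨ i = 2 * b ∨ i = 2 * b + 1 := by omega
    · simp only [oddProjector, mul_sub, mul_add, mul_smul_comm, ← mul_assoc, ih' i hlt, zero_mul,
        smul_zero, sub_zero, add_zero]
    · rcases b with _ | d
      · have e1 := hU.sq 0 (by omega)
        have e2 := hU.up 0 (by omega)
        simp only [zero_add] at e2
        simp [oddProjector, mul_sub, ← mul_assoc, e1, e2]
      · exact (oddProjector_step hU d (by omega) (hk _ (by omega) (by omega))
          (hk _ (by omega) (by omega)) ih').1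
    · have hv : oddProjector k U b * U (2 * b + 1) = U (2 * b + 1) * oddProjector k U b :=
        oddProjector_commute b fun i hi => hU.far _ _ (by omega) (by omega)
      have hv' (z : R) : U (2 * b + 1) * (oddProjector k U b * z) =
          oddProjector k U b * (U (2 * b + 1) * z) := by rw [← mul_assoc, ← hv, mul_assoc]
      have e1 : U (2 * b + 1) * U (2 * b + 1) = 0 := hU.sq _ (by omega)
      have e2 : U (2 * b + 1) * U (2 * b) * U (2 * b + 1) = U (2 * b + 1) := hU.down _ (by omega)
      have e3 : ((b : k) / (b + 1)) • (U (2 * b + 1) * (oddProjector k U b *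
          (U (2 * b) * U (2 * b - 1) * U (2 * b + 1) * U (2 * b)) * oddProjector k U b)) = 0 := by
        rcases Nat.eq_zero_or_pos b with rfl | hpos
        · simp
        · have e4 : U (2 * b - 1) * U (2 * b + 1) = U (2 * b + 1) * U (2 * b - 1) :=
            hU.far _ _ (by omega) (by omega)
          have e5 : U (2 * b + 1) * (U (2 * b) * U (2 * b - 1) * U (2 * b + 1) * U (2 * b)) =
              U (2 * b - 1) * U (2 * b + 1) * U (2 * b) := by
            rw [mul_assoc (U (2 * b)), e4]
            simp only [← mul_assoc]
            rw [e2]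
          -- Annihilation from the right comes from the induction hypothesis for the reversed
          -- generators.
          have e6 : oddProjector k U b * U (2 * b - 1) = 0 := by
            have := ih hU.op (by omega) (fun j h h' => hk j h (by omega)) (2 * b - 1) (by omega)
            rw [oddProjector_op hU b (by omega), ← MulOpposite.op_mul] at this
            exact MulOpposite.op_injective this
          rw [mul_assoc (oddProjector k U b), hv', ← mul_assoc (U (2 * b + 1)), e5]
          simp only [← mul_assoc]
          rw [e6]
          simp
      rw [oddProjector, mul_sub, mul_sub, mul_add, mul_smul_comm, e3]
      simp only [mul_assoc, hv']
      simp only [← mul_assoc, e1, e2, mul_zero, zero_mul]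
      rw [hv, mul_assoc (U (2 * b + 1)), hff]
      abel

theorem oddProjector_mul_gen {U : ℕ → R} {M : ℕ} (hU : TLRelations U M) (b : ℕ) (hb : 2 * b ≤ M)
    (hk : ∀ j, 1 ≤ j → j ≤ b → (j : k) ≠ 0) (i : ℕ) (hi : i < 2 * b) :
    oddProjector k U b * U i = 0 := by
  have := gen_mul_oddProjector hU.op b hb hk i hi
  rw [oddProjector_op hU b hb, ← MulOpposite.op_mul] at this
  exact MulOpposite.op_injective this

theorem oddProjector_mul_oddProjector {U : ℕ → R} {M : ℕ} (hU : TLRelations U M) {b c : ℕ}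
    (hcb : c ≤ b) (hb : 2 * b ≤ M) (hk : ∀ j, 1 ≤ j → j ≤ b → (j : k) ≠ 0) :
    oddProjector k U c * oddProjector k U b = oddProjector k U b :=
  oddProjector_mul_of_kill c fun i hi => gen_mul_oddProjector hU b hb hk i (by omega)

theorem oddProjector_mul_oddProjector' {U : ℕ → R} {M : ℕ} (hU : TLRelations U M) {b c : ℕ}
    (hcb : c ≤ b) (hb : 2 * b ≤ M) (hk : ∀ j, 1 ≤ j → j ≤ b → (j : k) ≠ 0) :
    oddProjector k U b * oddProjector k U c = oddProjector k U b := by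
  have := oddProjector_mul_oddProjector hU.op hcb hb hk
  rw [oddProjector_op hU b hb, oddProjector_op hU c (by omega), ← MulOpposite.op_mul] at this
  exact MulOpposite.op_injective this

/-- Bending the last strand of a Jones-Wenzl projector inserted between two larger ones does not
change the morphism, because the loop value is zero. -/
theorem oddProjector_sandwich {U : ℕ → R} {M : ℕ} (hU : TLRelations U M) (b : ℕ)
    (hM : 2 * b + 2 ≤ M) (hk : ∀ j, 1 ≤ j → j ≤ b + 1 → (j : k) ≠ 0) :
    oddProjector k U b * (U (2 * b) * U (2 * b + 1) * oddProjector k U b * U (2 * b)) *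
      oddProjector k U b = oddProjector k U b * U (2 * b) * oddProjector k U b := by
  rcases b with _ | d
  · simpa [oddProjector] using hU.up 0 (by omega)
  · have hk' : ∀ j, 1 ≤ j → j ≤ d + 1 → (j : k) ≠ 0 := fun j h h' => hk j h (by omega)
    have h := (oddProjector_step (k := k) hU d (by omega) (hk _ (by omega) (by omega))
      (hk _ (by omega) (by omega)) (gen_mul_oddProjector hU _ (by omega) hk')).2
    -- The larger projector absorbs the smaller and kills `U (2 * d)`, which removes the error term
    -- of `oddProjector_step`.
    have h0 : oddProjector k U (d + 1) * oddProjector k U d * U (2 * d) = 0 := by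
      rw [oddProjector_mul_oddProjector' hU (by omega) (by omega) hk',
        oddProjector_mul_gen hU _ (by omega) hk' _ (by omega)]
    rw [mul_assoc]
    refine (congrArg (oddProjector k U (d + 1) * ·) h).trans ?_
    simp only [mul_sub, ← mul_assoc, h0, zero_mul, sub_zero]
    rfl

end OddProjector

/-! ### Braid words -/

/-- The first `M` terms of the sequence `σ` satisfy the braid relations. -/
structure BraidRelations {R : Type*} [Ring R] (σ : ℕ → R) (M : ℕ) : Prop where
  braid : ∀ i, i + 1 < M → σ (i + 1) * σ i * σ (i + 1) = σ i * σ (i + 1) * σ i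
  far : ∀ i j, i + 1 < j → j < M → σ i * σ j = σ j * σ i

/-- The braid word `σ_j σ_{j+1} ⋯ σ_{j+m-1}`. -/
def ascending {R : Type*} [Ring R] (σ : ℕ → R) (j : ℕ) : ℕ → R
  | 0 => 1
  | m + 1 => ascending σ j m * σ (j + m)

/-- The braid word `σ_{j+m-1} ⋯ σ_{j+1} σ_j`. -/
def descending {R : Type*} [Ring R] (σ : ℕ → R) (j : ℕ) : ℕ → R
  | 0 => 1
  | m + 1 => σ (j + m) * descending σ j m

section Braids

variable {R : Type*} [Ring R] {σ : ℕ → R} {M : ℕ}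

theorem BraidRelations.op (h : BraidRelations σ M) :
    BraidRelations (fun i => MulOpposite.op (σ i)) M where
  braid i hi := by
    simp only [← MulOpposite.op_mul]
    rw [← mul_assoc, h.braid i hi, mul_assoc]
  far i j hij hj := by rw [← MulOpposite.op_mul, ← MulOpposite.op_mul, h.far i j hij hj]

theorem ascending_op (j m : ℕ) :
    ascending (fun i => MulOpposite.op (σ i)) j m = MulOpposite.op (descending σ j m) := by
  induction m with
  | zero => rfl
  | succ m ih => rw [ascending, ih, descending, MulOpposite.op_mul]

theorem ascending_commute {x : R} (j m : ℕ) (h : ∀ i, j ≤ i → i < j + m → Commute (σ i) x) :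
    Commute (ascending σ j m) x := by
  induction m with
  | zero => exact Commute.one_left x
  | succ m ih =>
    exact (ih fun i hi hi' => h i hi (by omega)).mul_left (h _ (by omega) (by omega))

theorem map_ascending {S : Type*} [Ring S] (φ : R → S) (hone : φ 1 = 1)
    (hmul : ∀ x y, φ (x * y) = φ x * φ y) {τ : ℕ → S} (j m : ℕ)
    (h : ∀ i < j + m, φ (σ i) = τ i) : φ (ascending σ j m) = ascending τ j m := by
  induction m with
  | zero => exact hone
  | succ m ih => rw [ascending, hmul, ih fun i hi => h i (by omega), h _ (by omega), ascending]

/-- Far commutation moves the generator to the two letters where the braid relation applies; the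
relation lowers its index by one, and it then commutes with the remaining letters. -/
theorem gen_mul_ascending (hσ : BraidRelations σ M) (i j m : ℕ) (hj : j ≤ i) (hi : i + 1 < j + m)
    (hM : j + m ≤ M) : σ (i + 1) * ascending σ j m = ascending σ j m * σ i := by
  induction m with
  | zero => omega
  | succ m ih =>
    by_cases hlt : i + 1 < j + m
    · rw [ascending, ← mul_assoc, ih hlt (by omega), mul_assoc, hσ.far i _ hlt (by omega),
        mul_assoc]
    · obtain ⟨m, rfl⟩ : ∃ m', m = m' + 1 := ⟨m - 1, by omega⟩
      obtain rfl : i = j + m := by omega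
      have hc : ascending σ j m * σ (j + m + 1) = σ (j + m + 1) * ascending σ j m :=
        ascending_commute j m fun l _ hl => hσ.far l _ (by omega) (by omega)
      have hb := hσ.braid (j + m) (by omega)
      rw [ascending, ascending, ← add_assoc]
      simp only [← mul_assoc]
      rw [← hc, mul_assoc, mul_assoc, ← mul_assoc (σ (j + m + 1)), hb]
      simp only [mul_assoc]

theorem ascending_mul_ascending (hσ : BraidRelations σ M) (j l m : ℕ) (hl : l ≤ m)
    (hM : j + m + 1 ≤ M) : ascending σ (j + 1) l * ascending σ j (m + 1) =
      ascending σ j (m + 1) * ascending σ j l := by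
  induction l with
  | zero => simp [ascending]
  | succ l ih =>
    rw [ascending, mul_assoc, add_right_comm, gen_mul_ascending hσ _ _ _ (by omega) (by omega)
      (by omega), ← mul_assoc, ih (by omega), mul_assoc]
    rfl

theorem descending_mul_ascending (hσ : BraidRelations σ M) (j l m : ℕ) (hl : j + l ≤ m)
    (hM : m + 1 ≤ M) : descending σ (j + 1) l * ascending σ 0 (m + 1) =
      ascending σ 0 (m + 1) * descending σ j l := by
  induction l with
  | zero => simp [descending]
  | succ l ih =>
    rw [descending, mul_assoc, ih (by omega), ← mul_assoc, add_right_comm,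
      gen_mul_ascending hσ _ _ _ (by omega) (by omega) (by omega), mul_assoc, descending]

/-- Each new factor `σ_0 ⋯ σ_m` is carried past the accumulated descending word, lowering its
indices by one; its last letter `σ_m` then extends that word at the top. -/
theorem ascending_pow (hσ : BraidRelations σ M) (m i j : ℕ) (hij : i + j = m + 1)
    (hM : m + 1 ≤ M) :
    ascending σ 0 (m + 1) ^ i = ascending σ 0 m ^ i * descending σ j i := by
  induction i generalizing j with
  | zero => simp [descending]
  | succ i ih =>
    rw [pow_succ, ih (j + 1) (by omega), mul_assoc, descending_mul_ascending hσ _ _ _ (by omega) hM,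
      ascending, zero_add, pow_succ, descending, show j + i = m by omega]
    simp only [mul_assoc]

/-- The braid of the strand `m` around the strands to its left. -/
def jucysMurphy (σ : ℕ → R) (m : ℕ) : R := descending σ 0 m * ascending σ 0 m

theorem jucysMurphy_succ (m : ℕ) : jucysMurphy σ (m + 1) = σ m * jucysMurphy σ m * σ m := by
  simp only [jucysMurphy, descending, ascending, zero_add, mul_assoc]

/-- The full twist on `m + 2` strands in terms of the full twist on `m + 1` strands. -/
theorem fullTwist_eq (hσ : BraidRelations σ M) (m : ℕ) (hM : m + 1 ≤ M) :
    ascending σ 0 (m + 1) ^ (m + 2) = ascending σ 0 m ^ (m + 1) * jucysMurphy σ (m + 1) := by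
  rw [pow_succ, ascending_pow hσ m (m + 1) 0 rfl hM, mul_assoc, jucysMurphy]

/-- The generator becomes `σ (i + 1)` on passing the descending half and `σ i` again on passing the
ascending half. -/
theorem jucysMurphy_commute (hσ : BraidRelations σ M) (i m : ℕ) (hi : i + 1 < m) (hM : m ≤ M) :
    σ i * jucysMurphy σ m = jucysMurphy σ m * σ i := by
  have h := gen_mul_ascending hσ.op i 0 m (by omega) (by omega) (by omega)
  rw [ascending_op, ← MulOpposite.op_mul, ← MulOpposite.op_mul] at h
  have h' := MulOpposite.op_injective h
  rw [jucysMurphy, ← mul_assoc, ← h', mul_assoc,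
    gen_mul_ascending hσ i 0 m (by omega) (by omega) (by omega), mul_assoc]

end Braids

/-! ### The Kauffman bracket at a primitive fourth root of unity -/

section Kauffman

variable {k R : Type*} [Field k] [Ring R] [Algebra k R]

/-- The crossing resolved by the Kauffman bracket rule. -/
def kauffman (s : k) (U : ℕ → R) (i : ℕ) : R := s • 1 + s⁻¹ • U i

variable {U : ℕ → R} {M : ℕ} {s : k}

theorem inv_eq_of_pow_four (hs : s ^ 4 = -1) : s⁻¹ = -s ^ 3 := by
  have h0 : s ≠ 0 := by rintro rfl; simp at hs
  field_simp
  linear_combination hs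

theorem kauffman_mul_of_kill {x : R} {i : ℕ} (h : U i * x = 0) :
    kauffman s U i * x = s • x := by
  simp [kauffman, add_mul, h]

/-- The bracket rule gives the braid relation exactly when the loop value is `-(s² + s⁻²)`; with `U
i * U i = 0` this is the condition `s ^ 4 = -1`. -/
theorem kauffman_relations (hU : TLRelations U M) (hs : s ^ 4 = -1) :
    BraidRelations (kauffman s U) M where
  braid i hi := by
    have e1 := hU.sq i (by omega)
    have e2 := hU.sq (i + 1) hi
    have e3 := hU.up i hi
    have e4 := hU.down i hi
    simp only [kauffman, add_mul, mul_add, smul_mul_assoc, mul_smul_comm, one_mul, mul_one, e1, e2,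
      e3, e4, smul_zero, inv_eq_of_pow_four hs]
    match_scalars <;>
      first | ring1 | linear_combination (-s ^ 5) * hs | linear_combination s ^ 5 * hs
  far i j hij hj := by
    simp only [kauffman, add_mul, mul_add, smul_mul_assoc, mul_smul_comm, one_mul, mul_one,
      hU.far i j hij hj]
    module

/-- A generator is an affine combination of its crossing and `1`, so it inherits commutation from
the crossing. -/
theorem jucysMurphy_commute_gen (hU : TLRelations U M) (hs : s ^ 4 = -1) (i m : ℕ)
    (hi : i + 1 < m) (hM : m ≤ M) : Commute (U i) (jucysMurphy (kauffman s U) m) := by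
  have h0 : s ≠ 0 := by rintro rfl; simp at hs
  have h : Commute (kauffman s U i) (jucysMurphy (kauffman s U) m) :=
    jucysMurphy_commute (kauffman_relations hU hs) i m hi hM
  have e : U i = s • (kauffman s U i - s • 1) := by
    simp [kauffman, smul_smul, h0]
  rw [e]
  exact (h.sub_left ((Commute.one_left _).smul_left s)).smul_left s

/-- Induction by `J_{m+2} = σ_{m+1} J_{m+1} σ_{m+1}`: the outer crossings are absorbed into `x` and
`y`, which are still killed by the generators of index below `m`. This is why `x` and `y` are
arbitrary elements instead of a fixed projector. -/
theorem compress_jucysMurphy (hU : TLRelations U M) (hs : s ^ 4 = -1) (m : ℕ) (hM : m + 1 ≤ M)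
    (x y : R) (hx : ∀ i < m, x * U i = 0) (hy : ∀ i < m, U i * y = 0) :
    x * jucysMurphy (kauffman s U) (m + 1) * y = (s ^ 2) ^ (m + 1) • (x * y) +
      (if Even m then 2 * (s ^ 2) ^ m else 0) • (x * U m * y) := by
  have h0 : s ≠ 0 := by rintro rfl; simp at hs
  have hinv := inv_eq_of_pow_four hs
  have hsq (m : ℕ) (hm : m < M) (x y : R) : x * kauffman s U m * (kauffman s U m * y) =
      s ^ 2 • (x * y) + (2 : k) • (x * U m * y) := by
    have : kauffman s U m * kauffman s U m = s ^ 2 • (1 : R) + (2 : k) • U m := by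
      simp only [kauffman, add_mul, mul_add, smul_mul_assoc, mul_smul_comm, one_mul, mul_one,
        hU.sq m hm, smul_zero]
      match_scalars <;> field_simp
      norm_num
    rw [mul_assoc, ← mul_assoc (kauffman s U m), this]
    simp only [add_mul, mul_add, smul_mul_assoc, mul_smul_comm, one_mul, mul_assoc]
  induction m generalizing x y with
  | zero =>
    have := hsq 0 (by omega) x y
    simpa [jucysMurphy_succ, jucysMurphy, descending, ascending, mul_assoc] using this
  | succ m ih =>
    have hfar (i : ℕ) (hi : i < m) : Commute (kauffman s U (m + 1)) (U i) :=
      ((Commute.one_left _).smul_left s).add_left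
        ((show Commute (U (m + 1)) (U i) from
          (hU.far i (m + 1) (by omega) (by omega)).symm).smul_left _)
    have hx' : ∀ i < m, x * kauffman s U (m + 1) * U i = 0 := fun i hi => by
      rw [mul_assoc, (hfar i hi).eq, ← mul_assoc, hx i (by omega), zero_mul]
    have hy' : ∀ i < m, U i * (kauffman s U (m + 1) * y) = 0 := fun i hi => by
      rw [← mul_assoc, ← (hfar i hi).eq, mul_assoc, hy i (by omega), mul_zero]
    have key := ih (by omega) _ _ hx' hy'
    have e1 := hx m (by omega)
    have e2 := hy m (by omega)
    have e3 : x * kauffman s U (m + 1) * U m * (kauffman s U (m + 1) * y) =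
        (s⁻¹ ^ 2) • (x * U (m + 1) * y) := by
      have e4 : U (m + 1) * (U m * (U (m + 1) * y)) = U (m + 1) * y := by
        rw [← mul_assoc, ← mul_assoc, hU.down m (by omega)]
      simp only [kauffman, add_mul, mul_add, smul_mul_assoc, mul_smul_comm, one_mul, mul_one, e1,
        smul_zero, zero_add, mul_assoc, e2, mul_zero, e4, smul_smul, pow_two]
    rw [jucysMurphy_succ]
    have e5 : x * (kauffman s U (m + 1) * jucysMurphy (kauffman s U) (m + 1) *
        kauffman s U (m + 1)) * y = x * kauffman s U (m + 1) * jucysMurphy (kauffman s U) (m + 1) *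
        (kauffman s U (m + 1) * y) := by simp only [mul_assoc]
    rw [e5, key, hsq (m + 1) (by omega), e3, hinv]
    -- The coefficient of `U (m + 1)` is `2ζ^(m+1)` plus `ζ⁻¹` times the previous one. For even `m`
    -- the sum is `2ζ^(m-1)(ζ² + 1) = 0`; for odd `m` the previous coefficient is zero.
    by_cases hm : Even m
    · have hm' : ¬ Even (m + 1) := by simpa [Nat.even_add_one] using hm
      simp only [hm, hm', if_true, if_false]
      match_scalars <;> first | ring1 | linear_combination (2 * (s ^ 2) ^ m * s ^ 2) * hs
    · have hm' : Even (m + 1) := by simpa [Nat.even_add_one] using hm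
      simp only [hm, hm', if_true, if_false]
      module

end Kauffman

/-! ## Composition in the Temperley-Lieb category -/

namespace Tangle

theorem id_stack {m n : ℕ} (t : Tangle m n) : stack .id t = t := by
  induction t with
  | id => rfl
  | cup i hi t ih => rw [stack, ih]
  | cap i hi t ih => rw [stack, ih]

theorem stack_assoc {a b c d : ℕ} (r : Tangle a b) (s : Tangle b c) (t : Tangle c d) :
    stack (stack r s) t = stack r (stack s t) := by
  induction t with
  | id => rfl
  | cup i hi t ih => rw [stack, stack, stack, ih]
  | cap i hi t ih => rw [stack, stack, stack, ih]

theorem addRight_stack {a b c : ℕ} (r : Tangle a b) (t : Tangle b c) :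
    (stack r t).addRight = stack r.addRight t.addRight := by
  induction t with
  | id => rfl
  | cup i hi t ih => rw [stack, addRight, addRight, stack, ih]
  | cap i hi t ih => rw [stack, addRight, addRight, stack, ih]

end Tangle

noncomputable section

namespace TL

variable {k : Type*} [Field k] {δ : k}

theorem span_range_ofTangle (m n : ℕ) :
    Submodule.span k (Set.range (ofTangle δ : Tangle m n → TL δ m n)) = ⊤ := by
  have h : (Submodule.span k (Set.range (ofTangle δ : Tangle m n → TL δ m n))).mkQ = 0 :=
    hom_ext fun t => (Submodule.Quotient.mk_eq_zero _).2 (Submodule.subset_span ⟨t, rfl⟩)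
  rw [← Submodule.ker_mkQ (Submodule.span k (Set.range (ofTangle δ : Tangle m n → TL δ m n))), h,
    LinearMap.ker_zero]

theorem induction_on {m n : ℕ} {P : TL δ m n → Prop} (f : TL δ m n)
    (tangle : ∀ t, P (ofTangle δ t)) (zero : P 0) (add : ∀ f g, P f → P g → P (f + g))
    (smul : ∀ (c : k) f, P f → P (c • f)) : P f := by
  have hf : f ∈ Submodule.span k (Set.range (ofTangle δ : Tangle m n → TL δ m n)) := by
    rw [span_range_ofTangle]; trivial
  induction hf using Submodule.span_induction with
  | mem x hx => obtain ⟨t, rfl⟩ := hx; exact tangle t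
  | zero => exact zero
  | add x y _ _ hx hy => exact add x y hx hy
  | smul c x _ hx => exact smul c x hx

theorem comp_add {l m n : ℕ} (g : TL δ m n) (f f' : TL δ l m) :
    g ⊚ (f + f') = g ⊚ f + g ⊚ f' := map_add _ _ _

theorem comp_smul {l m n : ℕ} (c : k) (g : TL δ m n) (f : TL δ l m) :
    g ⊚ (c • f) = c • (g ⊚ f) := map_smul _ _ _

theorem comp_zero {l m n : ℕ} (g : TL δ m n) : g ⊚ (0 : TL δ l m) = 0 := map_zero _

theorem add_comp {l m n : ℕ} (g g' : TL δ m n) (f : TL δ l m) :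
    (g + g') ⊚ f = g ⊚ f + g' ⊚ f := LinearMap.map_add₂ _ _ _ _

theorem smul_comp {l m n : ℕ} (c : k) (g : TL δ m n) (f : TL δ l m) :
    (c • g) ⊚ f = c • (g ⊚ f) := LinearMap.map_smul₂ _ _ _ _

theorem zero_comp {l m n : ℕ} (f : TL δ l m) : (0 : TL δ m n) ⊚ f = 0 :=
  LinearMap.map_zero₂ _ _

theorem one_comp {m n : ℕ} (f : TL δ m n) : one δ n ⊚ f = f := by
  induction f using induction_on with
  | tangle t => rw [one, comp_ofTangle]; rfl
  | zero => exact comp_zero _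
  | add f g hf hg => rw [comp_add, hf, hg]
  | smul c f hf => rw [comp_smul, hf]

theorem comp_one {m n : ℕ} (f : TL δ m n) : f ⊚ one δ m = f := by
  induction f using induction_on with
  | tangle t => rw [one, comp_ofTangle, Tangle.id_stack]
  | zero => exact zero_comp _
  | add f g hf hg => rw [add_comp, hf, hg]
  | smul c f hf => rw [smul_comp, hf]

theorem comp_assoc {a b c d : ℕ} (h : TL δ c d) (g : TL δ b c) (f : TL δ a b) :
    (h ⊚ g) ⊚ f = h ⊚ g ⊚ f := by
  induction h using induction_on with
  | zero => simp only [zero_comp]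
  | add h h' e e' => simp only [add_comp, e, e']
  | smul c h e => simp only [smul_comp, e]
  | tangle t =>
    induction g using induction_on with
    | zero => simp only [zero_comp, comp_zero]
    | add h h' e e' => simp only [add_comp, comp_add, e, e']
    | smul c h e => simp only [smul_comp, comp_smul, e]
    | tangle s =>
      induction f using induction_on with
      | zero => simp only [comp_zero]
      | add h h' e e' => simp only [comp_add, e, e']
      | smul c h e => simp only [comp_smul, e]
      | tangle r => simp only [comp_ofTangle, Tangle.stack_assoc]

/-- The endomorphisms of an object form a ring under composition. -/
scoped instance instRing (n : ℕ) : Ring (TL δ n n) where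
  __ := (inferInstance : AddCommGroup (TL δ n n))
  mul g f := g ⊚ f
  one := one δ n
  mul_assoc := comp_assoc
  one_mul := one_comp
  mul_one := comp_one
  left_distrib := comp_add
  right_distrib := add_comp
  zero_mul := zero_comp
  mul_zero := comp_zero

scoped instance instAlgebra (n : ℕ) : Algebra k (TL δ n n) :=
  Algebra.ofModule smul_comp (fun c g f => comp_smul c g f)

theorem comp_eq_mul {n : ℕ} (g f : TL δ n n) : g ⊚ f = g * f := rfl

theorem one_eq (n : ℕ) : one δ n = 1 := rfl

/-! ### Relations between cups and caps -/

theorem ofTangle_cup {m n : ℕ} (i : ℕ) (hi : i ≤ n) (t : Tangle m n) :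
    ofTangle δ (.cup i hi t) = cupAt δ n i hi ⊚ ofTangle δ t := by
  rw [cupAt, comp_ofTangle]; rfl

theorem ofTangle_cap {m n : ℕ} (i : ℕ) (hi : i ≤ n) (t : Tangle m (n + 2)) :
    ofTangle δ (.cap i hi t) = capAt δ n i hi ⊚ ofTangle δ t := by
  rw [capAt, comp_ofTangle]; rfl

theorem cap_cup_self (n i : ℕ) (hi : i ≤ n) :
    capAt δ n i hi ⊚ cupAt δ n i hi = δ • one δ n := by
  rw [cupAt, ← ofTangle_cap]
  exact ofTangle_loop (.loop i hi _)

theorem cap_cup_succ (n i : ℕ) (hi : i + 1 ≤ n) :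
    capAt δ n i (by omega) ⊚ cupAt δ n (i + 1) hi = one δ n := by
  rw [cupAt, ← ofTangle_cap]
  exact ofTangle_isotopy (.zigzag i hi _)

theorem cap_succ_cup (n i : ℕ) (hi : i + 1 ≤ n) :
    capAt δ n (i + 1) hi ⊚ cupAt δ n i (by omega) = one δ n := by
  rw [cupAt, ← ofTangle_cap]
  exact ofTangle_isotopy (.zagzig i hi _)

theorem cup_cup (n i j : ℕ) (hij : i ≤ j) (hj : j ≤ n) :
    cupAt δ (n + 2) i (by omega) ⊚ cupAt δ n j hj =
      cupAt δ (n + 2) (j + 2) (by omega) ⊚ cupAt δ n i (by omega) := by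
  rw [cupAt, cupAt, comp_ofTangle, cupAt, cupAt, comp_ofTangle]
  exact ofTangle_isotopy (.cup_cup i j hij hj _)

theorem cap_cap (n i j : ℕ) (hij : i ≤ j) (hj : j ≤ n) :
    capAt δ n j hj ⊚ capAt δ (n + 2) i (by omega) =
      capAt δ n i (by omega) ⊚ capAt δ (n + 2) (j + 2) (by omega) := by
  rw [capAt, capAt, comp_ofTangle, capAt, capAt, comp_ofTangle]
  exact ofTangle_isotopy (.cap_cap i j hij hj _)

theorem cap_cup_of_le (n i j : ℕ) (hij : i ≤ j) (hj : j ≤ n) :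
    capAt δ (n + 2) (j + 2) (by omega) ⊚ cupAt δ (n + 2) i (by omega) =
      cupAt δ n i (by omega) ⊚ capAt δ n j hj := by
  rw [capAt, cupAt, comp_ofTangle, capAt, cupAt, comp_ofTangle]
  exact ofTangle_isotopy (.cup_left_cap i j hij hj _)

theorem cap_cup_of_ge (n i j : ℕ) (hij : i ≤ j) (hj : j ≤ n) :
    capAt δ (n + 2) i (by omega) ⊚ cupAt δ (n + 2) (j + 2) (by omega) =
      cupAt δ n j hj ⊚ capAt δ n i (by omega) := by
  rw [capAt, cupAt, comp_ofTangle, capAt, cupAt, comp_ofTangle]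
  exact ofTangle_isotopy (.cap_left_cup i j hij hj _)

/-- The standard generator `1 ⊗ ∪∩ ⊗ 1` on `N` strands, with `i` strands to its left. -/
def gen (δ : k) : (N i : ℕ) → TL δ N N
  | n + 2, i => if hi : i ≤ n then cupAt δ n i hi ⊚ capAt δ n i hi else 0
  | _, _ => 0

theorem gen_eq (n i : ℕ) (hi : i ≤ n) :
    gen δ (n + 2) i = cupAt δ n i hi ⊚ capAt δ n i hi := dif_pos hi

theorem cup_cap_succ (n i : ℕ) (hi : i + 1 ≤ n) :
    cupAt δ n i (by omega) ⊚ capAt δ n (i + 1) hi = gen δ (n + 2) i * gen δ (n + 2) (i + 1) := by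
  rw [gen_eq n i (by omega), gen_eq n (i + 1) hi, ← comp_eq_mul, comp_assoc,
    ← comp_assoc (capAt δ n i _), cap_cup_succ, one_comp]

theorem cup_succ_cap (n i : ℕ) (hi : i + 1 ≤ n) :
    cupAt δ n (i + 1) hi ⊚ capAt δ n i (by omega) = gen δ (n + 2) (i + 1) * gen δ (n + 2) i := by
  rw [gen_eq n i (by omega), gen_eq n (i + 1) hi, ← comp_eq_mul, comp_assoc,
    ← comp_assoc (capAt δ n (i + 1) _), cap_succ_cup, one_comp]

/-- The nested double cup on top of the nested double cap. -/
theorem cup_cup_cap_cap (m : ℕ) :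
    cupAt δ (m + 2) (m + 1) (by omega) ⊚ cupAt δ m m le_rfl ⊚ capAt δ m m le_rfl ⊚
      capAt δ (m + 2) (m + 1) (by omega) = gen δ (m + 4) (m + 1) * gen δ (m + 4) m *
        gen δ (m + 4) (m + 2) * gen δ (m + 4) (m + 1) := by
  rw [mul_assoc, mul_assoc, ← cup_succ_cap (m + 2) (m + 1) (by omega), ← mul_assoc,
    ← cup_succ_cap (m + 2) m (by omega), ← comp_eq_mul, comp_assoc,
    ← comp_assoc (capAt δ (m + 2) m _), cap_cup_of_ge m m m le_rfl le_rfl, comp_assoc]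

theorem tlRelations_gen (hδ : δ = 0) (N : ℕ) : TLRelations (gen δ N) (N - 1) where
  sq i hi := by
    obtain ⟨n, rfl⟩ : ∃ n, N = n + 2 := ⟨N - 2, by omega⟩
    rw [gen_eq n i (by omega), ← comp_eq_mul, comp_assoc, ← comp_assoc (capAt δ n i _),
      cap_cup_self, hδ, zero_smul, zero_comp, comp_zero]
  up i hi := by
    obtain ⟨n, rfl⟩ : ∃ n, N = n + 2 := ⟨N - 2, by omega⟩
    rw [← cup_cap_succ n i (by omega), gen_eq n i (by omega), ← comp_eq_mul, comp_assoc,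
      ← comp_assoc (capAt δ n (i + 1) _), cap_succ_cup, one_comp]
  down i hi := by
    obtain ⟨n, rfl⟩ : ∃ n, N = n + 2 := ⟨N - 2, by omega⟩
    rw [← cup_succ_cap n i (by omega), gen_eq n (i + 1) (by omega), ← comp_eq_mul, comp_assoc,
      ← comp_assoc (capAt δ n i _), cap_cup_succ, one_comp]
  far i j hij hj := by
    obtain ⟨n, rfl⟩ : ∃ n, N = n + 2 + 2 := ⟨N - 4, by omega⟩
    obtain ⟨j, rfl⟩ : ∃ j', j = j' + 2 := ⟨j - 2, by omega⟩
    rw [gen_eq (n + 2) i (by omega), gen_eq (n + 2) (j + 2) (by omega), ← comp_eq_mul,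
      ← comp_eq_mul, comp_assoc, ← comp_assoc (capAt δ (n + 2) i _),
      cap_cup_of_ge n i j (by omega) (by omega), comp_assoc,
      ← cap_cap n i j (by omega) (by omega), comp_assoc (cupAt δ (n + 2) (j + 2) _),
      ← comp_assoc (capAt δ (n + 2) (j + 2) _), cap_cup_of_le n i j (by omega) (by omega),
      comp_assoc, ← comp_assoc, cup_cup n i j (by omega) (by omega), comp_assoc]

/-! ### Adding a strand on the right -/

theorem rightId_ofTangle {m n : ℕ} (t : Tangle m n) :
    rightId (ofTangle δ t) = ofTangle δ t.addRight := lift_ofTangle _ _ _ _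

theorem rightId_one (n : ℕ) : rightId (one δ n) = one δ (n + 1) := rightId_ofTangle _

theorem rightId_comp {l m n : ℕ} (g : TL δ m n) (f : TL δ l m) :
    rightId (g ⊚ f) = rightId g ⊚ rightId f := by
  induction g using induction_on with
  | zero => simp only [zero_comp, map_zero]
  | add h h' e e' => simp only [add_comp, map_add, e, e']
  | smul c h e => simp only [smul_comp, map_smul, e]
  | tangle t =>
    induction f using induction_on with
    | zero => simp only [comp_zero, map_zero]
    | add h h' e e' => simp only [comp_add, map_add, e, e']
    | smul c h e => simp only [comp_smul, map_smul, e]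
    | tangle s => simp only [comp_ofTangle, rightId_ofTangle, Tangle.addRight_stack]

theorem rightId_mul {n : ℕ} (g f : TL δ n n) : rightId (g * f) = rightId g * rightId f :=
  rightId_comp g f

theorem rightId_cupAt (n i : ℕ) (hi : i ≤ n) :
    rightId (cupAt δ n i hi) = cupAt δ (n + 1) i (by omega) := rightId_ofTangle _

theorem rightId_capAt (n i : ℕ) (hi : i ≤ n) :
    rightId (capAt δ n i hi) = capAt δ (n + 1) i (by omega) := rightId_ofTangle _

theorem rightId_gen (N i : ℕ) (hi : i + 2 ≤ N) : rightId (gen δ N i) = gen δ (N + 1) i := by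
  obtain ⟨n, rfl⟩ : ∃ n, N = n + 2 := ⟨N - 2, by omega⟩
  rw [gen_eq n i (by omega), rightId_comp, rightId_cupAt, rightId_capAt]
  exact (gen_eq (n + 1) i (by omega)).symm

/-- Naturality of the cap: a morphism slides past a cap on its right. It suffices to slide
elementary cups and caps, which are height exchanges. -/
theorem cap_comp_rightId {m n : ℕ} (f : TL δ m n) :
    capAt δ n n le_rfl ⊚ rightId (rightId f) = f ⊚ capAt δ m m le_rfl := by
  induction f using induction_on with
  | zero => simp only [map_zero, zero_comp, comp_zero]
  | add h h' e e' => simp only [comp_add, add_comp, map_add, e, e']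
  | smul c h e => simp only [comp_smul, smul_comp, map_smul, e]
  | tangle t =>
    induction t with
    | id =>
      rw [show ofTangle δ .id = one δ m from rfl, rightId_one, rightId_one, one_comp]
      exact comp_one _
    | cup i hi t ih =>
      rw [ofTangle_cup, rightId_comp, rightId_comp, rightId_cupAt, rightId_cupAt, comp_assoc, ← ih,
        ← comp_assoc, ← comp_assoc]
      exact congrArg (· ⊚ rightId (rightId (ofTangle δ t))) (cap_cup_of_le _ i _ hi le_rfl)
    | cap i hi t ih =>
      rw [ofTangle_cap, rightId_comp, rightId_comp, rightId_capAt, rightId_capAt, comp_assoc, ← ih,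
        ← comp_assoc, ← comp_assoc]
      exact congrArg (· ⊚ rightId (rightId (ofTangle δ t))) (cap_cap _ i _ hi le_rfl)

theorem rightId_comp_cup {m n : ℕ} (f : TL δ m n) :
    rightId (rightId f) ⊚ cupAt δ m m le_rfl = cupAt δ n n le_rfl ⊚ f := by
  induction f using induction_on with
  | zero => simp only [map_zero, zero_comp, comp_zero]
  | add h h' e e' => simp only [comp_add, add_comp, map_add, e, e']
  | smul c h e => simp only [comp_smul, smul_comp, map_smul, e]
  | tangle t =>
    induction t with
    | id =>
      rw [show ofTangle δ .id = one δ m from rfl, rightId_one, rightId_one, comp_one]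
      exact one_comp _
    | cup i hi t ih =>
      rw [ofTangle_cup, rightId_comp, rightId_comp, rightId_cupAt, rightId_cupAt, comp_assoc, ih,
        ← comp_assoc, ← comp_assoc]
      exact congrArg (· ⊚ ofTangle δ t) (cup_cup _ i _ hi le_rfl)
    | cap i hi t ih =>
      rw [ofTangle_cap, rightId_comp, rightId_comp, rightId_capAt, rightId_capAt, comp_assoc, ih,
        ← comp_assoc, ← comp_assoc]
      exact congrArg (· ⊚ ofTangle δ t) (cap_cup_of_ge _ i _ hi le_rfl)

/-! ### The partial trace -/

theorem partialTrace_add {m n : ℕ} (f g : TL δ (m + 1) (n + 1)) :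
    partialTrace (f + g) = partialTrace f + partialTrace g := by
  simp only [partialTrace, map_add, add_comp, comp_add]

theorem partialTrace_smul {m n : ℕ} (c : k) (f : TL δ (m + 1) (n + 1)) :
    partialTrace (c • f) = c • partialTrace f := by
  simp only [partialTrace, map_smul, smul_comp, comp_smul]

/-- Factors not touching the last strand slide out of the closure, so the trace is a bimodule map;
twists are computed by peeling off one crossing at a time. -/
theorem partialTrace_sandwich {n : ℕ} (x y : TL δ n n) (f : TL δ (n + 1) (n + 1)) :
    partialTrace (rightId x * f * rightId y) = x * partialTrace f * y := by
  simp only [← comp_eq_mul, partialTrace, rightId_comp, comp_assoc, rightId_comp_cup]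
  rw [← comp_assoc (capAt δ n n _), cap_comp_rightId, comp_assoc]

theorem partialTrace_one (n : ℕ) : partialTrace (1 : TL δ (n + 1) (n + 1)) = δ • 1 := by
  rw [← one_eq, partialTrace, rightId_one, one_comp, cap_cup_self]; rfl

theorem partialTrace_gen (n : ℕ) : partialTrace (gen δ (n + 2) n) = 1 := by
  rw [partialTrace, gen_eq n n le_rfl, rightId_comp, rightId_cupAt, rightId_capAt, comp_assoc,
    ← comp_assoc (capAt δ (n + 1) (n + 1) _)]
  rw [cap_succ_cup (n + 1) n le_rfl, one_comp, cap_cup_succ (n + 1) n le_rfl]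
  rfl

/-! ### Normal form: caps below cups -/

/-- Composites of cups. -/
inductive IsCups (δ : k) (m : ℕ) : {n : ℕ} → TL δ m n → Prop
  | one : IsCups δ m (one δ m)
  | cup {n : ℕ} (i : ℕ) (hi : i ≤ n) {f : TL δ m n} (hf : IsCups δ m f) :
      IsCups δ m (cupAt δ n i hi ⊚ f)

/-- Composites of caps. -/
inductive IsCaps (δ : k) (m : ℕ) : {n : ℕ} → TL δ m n → Prop
  | one : IsCaps δ m (one δ m)
  | cap {n : ℕ} (i : ℕ) (hi : i ≤ n) {f : TL δ m (n + 2)} (hf : IsCaps δ m f) :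
      IsCaps δ m (capAt δ n i hi ⊚ f)

theorem IsCups.le {m n : ℕ} {f : TL δ m n} (hf : IsCups δ m f) : m ≤ n := by
  induction hf with
  | one => exact le_rfl
  | cup i hi _ ih => omega

theorem IsCaps.le {m n : ℕ} {f : TL δ m n} (hf : IsCaps δ m f) : n ≤ m := by
  induction hf with
  | one => exact le_rfl
  | cap i hi _ ih => omega

theorem IsCups.eq_one {n : ℕ} {f : TL δ n n} (hf : IsCups δ n f) : f = 1 := by
  cases hf with
  | one => rfl
  | cup i hi hf => have := hf.le; omega

theorem IsCaps.eq_one {n : ℕ} {f : TL δ n n} (hf : IsCaps δ n f) : f = 1 := by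
  cases hf with
  | one => rfl
  | cap i hi hf => have := hf.le; omega

theorem IsCups.exists_cup {m n : ℕ} {f : TL δ m (n + 2)} (hf : IsCups δ m f) (hm : m < n + 2) :
    ∃ (i : ℕ) (hi : i ≤ n) (g : TL δ m n), f = cupAt δ n i hi ⊚ g := by
  cases hf with
  | one => omega
  | cup i hi hf => exact ⟨i, hi, _, rfl⟩

theorem IsCaps.exists_cap {m n : ℕ} {f : TL δ (m + 2) n} (hf : IsCaps δ (m + 2) f)
    (hn : n < m + 2) :
    ∃ (i : ℕ) (hi : i ≤ m) (g : TL δ m n), f = g ⊚ capAt δ m i hi := by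
  induction hf with
  | one => omega
  | @cap n i hi f hf ih =>
    by_cases h : n + 2 < m + 2
    · obtain ⟨j, hj, g, rfl⟩ := ih h
      exact ⟨j, hj, capAt δ n i hi ⊚ g, (comp_assoc _ _ _).symm⟩
    · obtain rfl : n = m := by have := hf.le; omega
      rw [hf.eq_one]
      exact ⟨i, hi, TL.one δ n, (comp_one _).trans (one_comp _).symm⟩

/-- The morphisms spanned by composites of caps followed by cups. -/
def capsCups (δ : k) (m n : ℕ) : Submodule k (TL δ m n) :=
  Submodule.span k {x | ∃ (r : ℕ) (g : TL δ r n) (f : TL δ m r),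
    IsCups δ r g ∧ IsCaps δ m f ∧ x = g ⊚ f}

theorem cup_comp_mem_capsCups {m n : ℕ} (i : ℕ) (hi : i ≤ n) {x : TL δ m n}
    (hx : x ∈ capsCups δ m n) : cupAt δ n i hi ⊚ x ∈ capsCups δ m (n + 2) := by
  induction hx using Submodule.span_induction with
  | mem x hx =>
    obtain ⟨r, g, f, hg, hf, rfl⟩ := hx
    exact Submodule.subset_span ⟨r, _, f, hg.cup i hi, hf, (comp_assoc _ _ _).symm⟩
  | zero => rw [comp_zero]; exact zero_mem _
  | add x y _ _ hx hy => rw [comp_add]; exact add_mem hx hy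
  | smul c x _ hx => rw [comp_smul]; exact Submodule.smul_mem _ c hx

/-- A cap pushed down onto the topmost cup closes a loop, straightens a zigzag, or passes to a
diagram with two strands fewer, where the strong induction applies. -/
theorem cap_comp_cups_mem_capsCups {m : ℕ} (n : ℕ) : ∀ {r : ℕ} (i : ℕ) (hi : i ≤ n)
    {g : TL δ r (n + 2)} {f : TL δ m r} (_ : IsCups δ r g) (_ : IsCaps δ m f),
    capAt δ n i hi ⊚ g ⊚ f ∈ capsCups δ m n := by
  induction n using Nat.strong_induction_on with
  | _ n ih =>
    intro r i hi g f hg hf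
    cases hg with
    | one =>
      rw [one_comp]
      exact Submodule.subset_span ⟨n, _, _, .one, hf.cap i hi, (one_comp _).symm⟩
    | @cup _ j hj g hg =>
      have hgf : g ⊚ f ∈ capsCups δ m n := Submodule.subset_span ⟨r, g, f, hg, hf, rfl⟩
      rw [comp_assoc, ← comp_assoc]
      obtain h | h | h | h | h :
          i = j ∨ i + 1 = j ∨ j + 1 = i ∨ i + 2 ≤ j ∨ j + 2 ≤ i := by omega
      · subst h
        rw [cap_cup_self, smul_comp, one_comp]
        exact Submodule.smul_mem _ _ hgf
      · subst h
        rwa [cap_cup_succ, one_comp]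
      · subst h
        rwa [cap_succ_cup, one_comp]
      · obtain ⟨n, rfl⟩ : ∃ n', n = n' + 2 := ⟨n - 2, by omega⟩
        obtain ⟨j, rfl⟩ : ∃ j', j = j' + 2 := ⟨j - 2, by omega⟩
        rw [cap_cup_of_ge n i j (by omega) (by omega), comp_assoc]
        exact cup_comp_mem_capsCups _ _ (ih n (by omega) i _ hg hf)
      · obtain ⟨n, rfl⟩ : ∃ n', n = n' + 2 := ⟨n - 2, by omega⟩
        obtain ⟨i, rfl⟩ : ∃ i', i = i' + 2 := ⟨i - 2, by omega⟩
        rw [cap_cup_of_le n j i (by omega) (by omega), comp_assoc]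
        exact cup_comp_mem_capsCups _ _ (ih n (by omega) i _ hg hf)

theorem cap_comp_mem_capsCups {m n : ℕ} (i : ℕ) (hi : i ≤ n) {x : TL δ m (n + 2)}
    (hx : x ∈ capsCups δ m (n + 2)) : capAt δ n i hi ⊚ x ∈ capsCups δ m n := by
  induction hx using Submodule.span_induction with
  | mem x hx =>
    obtain ⟨r, g, f, hg, hf, rfl⟩ := hx
    exact cap_comp_cups_mem_capsCups n i hi hg hf
  | zero => rw [comp_zero]; exact zero_mem _
  | add x y _ _ hx hy => rw [comp_add]; exact add_mem hx hy
  | smul c x _ hx => rw [comp_smul]; exact Submodule.smul_mem _ c hx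

theorem mem_capsCups {m n : ℕ} (x : TL δ m n) : x ∈ capsCups δ m n := by
  induction x using induction_on with
  | zero => exact zero_mem _
  | add f g hf hg => exact add_mem hf hg
  | smul c f hf => exact Submodule.smul_mem _ c hf
  | tangle t =>
    induction t with
    | id => exact Submodule.subset_span ⟨m, _, _, .one, .one, (one_comp _).symm⟩
    | cup i hi t ih => rw [ofTangle_cup]; exact cup_comp_mem_capsCups i hi ih
    | cap i hi t ih => rw [ofTangle_cap]; exact cap_comp_mem_capsCups i hi ih

/-- In normal form a morphism out of fewer strands ends in a cup at the top, so killing single cups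
is enough. -/
theorem comp_eq_zero_of_cups {l m n : ℕ} (hm : m < n + 2) {e : TL δ (n + 2) l}
    (he : ∀ i hi, e ⊚ cupAt δ n i hi = 0) (g : TL δ m (n + 2)) : e ⊚ g = 0 := by
  induction mem_capsCups g using Submodule.span_induction with
  | mem x hx =>
    obtain ⟨r, g, f, hg, hf, rfl⟩ := hx
    obtain ⟨i, hi, g, rfl⟩ := hg.exists_cup (hf.le.trans_lt hm)
    rw [comp_assoc, ← comp_assoc, he, zero_comp]
  | zero => exact comp_zero _
  | add x y _ _ hx hy => rw [comp_add, hx, hy, add_zero]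
  | smul c x _ hx => rw [comp_smul, hx, smul_zero]

theorem comp_eq_zero_of_caps {l m n : ℕ} (hm : m < n + 2) {e : TL δ l (n + 2)}
    (he : ∀ i hi, capAt δ n i hi ⊚ e = 0) (f : TL δ (n + 2) m) : f ⊚ e = 0 := by
  induction mem_capsCups f using Submodule.span_induction with
  | mem x hx =>
    obtain ⟨r, g, f, hg, hf, rfl⟩ := hx
    obtain ⟨i, hi, f, rfl⟩ := hf.exists_cap (hg.le.trans_lt hm)
    rw [comp_assoc, comp_assoc, he, comp_zero, comp_zero]
  | zero => exact zero_comp _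
  | add x y _ _ hx hy => rw [add_comp, hx, hy, add_zero]
  | smul c x _ hx => rw [smul_comp, hx, smul_zero]

/-! ### The ideal of morphisms through fewer strands -/

theorem mul_mem_lower {n : ℕ} (y : TL δ n n) {x : TL δ n n} (hx : x ∈ lower δ n) :
    y * x ∈ lower δ n := by
  induction hx using Submodule.span_induction with
  | mem x hx =>
    obtain ⟨m, hm, g, f, rfl⟩ := hx
    exact Submodule.subset_span ⟨m, hm, y ⊚ g, f, (comp_assoc _ _ _).symm⟩
  | zero => rw [mul_zero]; exact zero_mem _
  | add x y _ _ hx hy => rw [mul_add]; exact add_mem hx hy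
  | smul c x _ hx => rw [mul_smul_comm]; exact Submodule.smul_mem _ c hx

theorem lower_mul_mem {n : ℕ} (y : TL δ n n) {x : TL δ n n} (hx : x ∈ lower δ n) :
    x * y ∈ lower δ n := by
  induction hx using Submodule.span_induction with
  | mem x hx =>
    obtain ⟨m, hm, g, f, rfl⟩ := hx
    exact Submodule.subset_span ⟨m, hm, g, f ⊚ y, comp_assoc _ _ _⟩
  | zero => rw [zero_mul]; exact zero_mem _
  | add x y _ _ hx hy => rw [add_mul]; exact add_mem hx hy
  | smul c x _ hx => rw [smul_mul_assoc]; exact Submodule.smul_mem _ c hx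

/-- A normal form through all `n` strands has no cups or caps, hence is the identity. This makes `e
End(n) e` one-dimensional at most for a Jones-Wenzl projector `e`. -/
theorem exists_sub_smul_one_mem_lower {n : ℕ} (x : TL δ n n) :
    ∃ c : k, x - c • 1 ∈ lower δ n := by
  induction mem_capsCups x using Submodule.span_induction with
  | mem x hx =>
    obtain ⟨r, g, f, hg, hf, rfl⟩ := hx
    rcases hf.le.lt_or_eq with h | rfl
    · exact ⟨0, by rw [zero_smul, sub_zero]; exact Submodule.subset_span ⟨r, h, g, f, rfl⟩⟩
    · refine ⟨1, ?_⟩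
      rw [hg.eq_one, hf.eq_one, comp_eq_mul, mul_one, one_smul, sub_self]
      exact zero_mem _
  | zero => exact ⟨0, by rw [zero_smul, sub_zero]; exact zero_mem _⟩
  | add x y _ _ hx hy =>
    obtain ⟨c, hc⟩ := hx
    obtain ⟨d, hd⟩ := hy
    exact ⟨c + d, by rw [add_smul, add_sub_add_comm]; exact add_mem hc hd⟩
  | smul a x _ hx =>
    obtain ⟨c, hc⟩ := hx
    exact ⟨a * c, by rw [mul_smul, ← smul_sub]; exact Submodule.smul_mem _ a hc⟩

theorem gen_mem_lower (N i : ℕ) : gen δ N i ∈ lower δ N := by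
  match N with
  | 0 => exact zero_mem _
  | 1 => exact zero_mem _
  | n + 2 =>
    rw [gen]
    split_ifs with h
    · exact Submodule.subset_span ⟨n, by omega, _, _, rfl⟩
    · exact zero_mem _

/-! ### Jones-Wenzl projectors -/

theorem IsJonesWenzl.mul_lower {n : ℕ} {e x : TL δ (n + 2) (n + 2)} (he : IsJonesWenzl e)
    (hx : x ∈ lower δ (n + 2)) : e * x = 0 := by
  induction hx using Submodule.span_induction with
  | mem x hx =>
    obtain ⟨m, hm, g, f, rfl⟩ := hx
    rw [← comp_eq_mul, ← comp_assoc, comp_eq_zero_of_cups hm (fun i hi => (he.2 i hi).2), zero_comp]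
  | zero => exact mul_zero _
  | add x y _ _ hx hy => rw [mul_add, hx, hy, add_zero]
  | smul c x _ hx => rw [mul_smul_comm, hx, smul_zero]

theorem IsJonesWenzl.lower_mul {n : ℕ} {e x : TL δ (n + 2) (n + 2)} (he : IsJonesWenzl e)
    (hx : x ∈ lower δ (n + 2)) : x * e = 0 := by
  induction hx using Submodule.span_induction with
  | mem x hx =>
    obtain ⟨m, hm, g, f, rfl⟩ := hx
    rw [← comp_eq_mul, comp_assoc, comp_eq_zero_of_caps hm (fun i hi => (he.2 i hi).1), comp_zero]
  | zero => exact zero_mul _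
  | add x y _ _ hx hy => rw [add_mul, hx, hy, add_zero]
  | smul c x _ hx => rw [smul_mul_assoc, hx, smul_zero]

theorem IsJonesWenzl.unique {n : ℕ} {e e' : TL δ n n} (he : IsJonesWenzl e)
    (he' : IsJonesWenzl e') : e = e' := by
  match n with
  | 0 => exact Eq.trans he (Eq.symm he')
  | 1 => exact Eq.trans he (Eq.symm he')
  | n + 2 =>
    have h1 := he.mul_lower he'.1
    have h2 := he'.lower_mul he.1
    rw [one_eq, mul_sub, mul_one, sub_eq_zero] at h1
    rw [one_eq, sub_mul, one_mul, sub_eq_zero] at h2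
    rw [h1, ← h2]

theorem IsJonesWenzl.jonesWenzl_eq {n : ℕ} {e : TL δ n n} (he : IsJonesWenzl e) :
    jonesWenzl δ n = e := by
  have h : ∃ e : TL δ n n, IsJonesWenzl e := ⟨e, he⟩
  rw [jonesWenzl, dif_pos h]
  exact h.choose_spec.unique he

/-- Any `f` with `e f = f` is a scalar multiple of `e`, since `e` kills everything through fewer
strands; an idempotent multiple has scalar `0` or `1`, unless `e` itself is zero. -/
theorem IsJonesWenzl.isTilting {n : ℕ} {e : TL δ (n + 2) (n + 2)} (he : IsJonesWenzl e) :
    IsTilting e := by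
  have hee : e * e = e := by
    have := he.mul_lower he.1
    rw [one_eq, mul_sub, mul_one, sub_eq_zero] at this
    exact this.symm
  refine ⟨hee, he.1, fun f hff hef hfe => ?_⟩
  rw [comp_eq_mul] at hff hef hfe
  obtain ⟨c, hc⟩ := exists_sub_smul_one_mem_lower f
  have hf : f = c • e := by
    have := he.mul_lower hc
    rw [mul_sub, hef, mul_smul_comm, mul_one, sub_eq_zero] at this
    exact this
  have h : (c * (c - 1)) • e = 0 := by
    rw [hf, smul_mul_smul_comm, hee] at hff
    rw [mul_sub, mul_one, sub_smul, hff, sub_self]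
  rcases smul_eq_zero.1 h with h | h
  · rcases mul_eq_zero.1 h with h | h
    · left; rw [hf, h, zero_smul]
    · right; rw [hf, sub_eq_zero.1 h, one_smul]
  · left; rw [hf, h, smul_zero]

theorem one_sub_oddProjector_mem_lower (N b : ℕ) :
    one δ N - oddProjector k (gen δ N) b ∈ lower δ N := by
  induction b with
  | zero => rw [oddProjector, one_eq, sub_self]; exact zero_mem _
  | succ b ih =>
    have h (x y z : TL δ N N) (i : ℕ) : x * (y * gen δ N i) * z ∈ lower δ N :=
      lower_mul_mem _ (mul_mem_lower _ (mul_mem_lower _ (gen_mem_lower N i)))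
    rw [oddProjector, ← sub_add, ← sub_add, ← sub_sub]
    exact add_mem (add_mem (sub_mem ih (Submodule.smul_mem _ _ (h _ _ _ _))) (h _ _ _ _))
      (h _ _ _ _)

theorem isJonesWenzl_oddProjector (hδ : δ = 0) (b : ℕ)
    (hk : ∀ j, 1 ≤ j → j ≤ b → (j : k) ≠ 0) :
    IsJonesWenzl (oddProjector k (gen δ (2 * b + 1)) b) := by
  rcases b with _ | b
  · rfl
  · have hU := tlRelations_gen hδ (2 * b + 1 + 2)
    change IsJonesWenzl (n := 2 * b + 1 + 2) (oddProjector k (gen δ (2 * b + 1 + 2)) (b + 1))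
    refine ⟨one_sub_oddProjector_mem_lower _ _, fun i hi => ?_⟩
    have h1 := gen_mul_oddProjector hU (b + 1) (by omega) hk i (by omega)
    have h2 := oddProjector_mul_gen hU (b + 1) (by omega) hk i (by omega)
    generalize oddProjector k (gen δ (2 * b + 1 + 2)) (b + 1) = e at h1 h2 ⊢
    rw [gen_eq _ i hi, ← comp_eq_mul] at h1 h2
    -- A zigzag with a neighbouring strand rewrites a single cap or cup through the generator `i`.
    -- The neighbour is on the right when there is one, otherwise on the left.
    by_cases h : i + 1 ≤ 2 * b + 1
    · constructor
      · rw [← one_comp (capAt δ (2 * b + 1) i hi), ← cap_succ_cup _ i h, comp_assoc, comp_assoc,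
          ← comp_assoc (cupAt δ _ i _), h1, comp_zero]
      · rw [← comp_one (cupAt δ (2 * b + 1) i hi), ← cap_cup_succ _ i h, ← comp_assoc,
          ← comp_assoc, comp_assoc e, h2, zero_comp]
    · obtain ⟨i, rfl⟩ : ∃ j, i = j + 1 := ⟨i - 1, by omega⟩
      constructor
      · rw [← one_comp (capAt δ (2 * b + 1) (i + 1) hi), ← cap_cup_succ _ i hi, comp_assoc,
          comp_assoc, ← comp_assoc (cupAt δ _ (i + 1) _), h1, comp_zero]
      · rw [← comp_one (cupAt δ (2 * b + 1) (i + 1) hi), ← cap_succ_cup _ i hi, ← comp_assoc,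
          ← comp_assoc, comp_assoc e, h2, zero_comp]

theorem rightId_oddProjector (N b : ℕ) (hb : 2 * b + 1 ≤ N) :
    rightId (oddProjector k (gen δ N) b) = oddProjector k (gen δ (N + 1)) b :=
  map_oddProjector (rightId : TL δ N N →ₗ[k] TL δ (N + 1) (N + 1)) (rightId_one N) rightId_mul b
    fun i hi => rightId_gen N i (by omega)

theorem E_odd (hδ : δ = 0) (b : ℕ) (hk : ∀ j, 1 ≤ j → j ≤ b → (j : k) ≠ 0) :
    E δ (2 * b + 1) = oddProjector k (gen δ (2 * b + 1)) b := by
  rw [E, if_pos (by simp), (isJonesWenzl_oddProjector hδ b hk).jonesWenzl_eq]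

theorem E_even (hδ : δ = 0) (b : ℕ) (hk : ∀ j, 1 ≤ j → j ≤ b → (j : k) ≠ 0) :
    E δ (2 * b + 2) = oddProjector k (gen δ (2 * b + 2)) b := by
  rw [E, if_neg (by simp), (isJonesWenzl_oddProjector hδ b hk).jonesWenzl_eq,
    rightId_oddProjector _ _ le_rfl]

/-- The projector on `2b + 3` strands is itself a primitive idempotent of the kind generating the
ideal, once `2b + 4 ≥ 2p`. -/
theorem toVer_E_eq_zero {p : ℕ} (hδ : δ = 0) (b : ℕ) (hb : 2 * p ≤ 2 * b + 4)
    (hk : ∀ j, 1 ≤ j → j ≤ b + 1 → (j : k) ≠ 0) : toVer p (E δ (2 * b + 3)) = 0 := by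
  have he := isJonesWenzl_oddProjector hδ (b + 1) hk
  refine (Submodule.Quotient.mk_eq_zero _).2 (Submodule.subset_span
    ⟨2 * b + 3, oddProjector k (gen δ (2 * b + 3)) (b + 1), one δ _, one δ _, by omega,
      IsJonesWenzl.isTilting (n := 2 * b + 1) he, ?_⟩)
  rw [comp_one, one_comp]
  exact E_odd hδ (b + 1) hk

end TL

end

/-! ### Compression with one extra strand, and powers of braid words on annihilated elements -/

section Kauffman

variable {k R : Type*} [Field k] [Ring R] [Algebra k R] {U : ℕ → R} {M : ℕ} {s : k}

/-- One more conjugation by a crossing, now without assuming that `U m` kills `x` or `y`. The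
contributions to `x U (m + 1) y` are `2ζ^(m+1)` and `2ζ^(m-1)`, which cancel because `ζ² = -1`. -/
theorem compress_jucysMurphy_succ (hU : TLRelations U M) (hs : s ^ 4 = -1) (m : ℕ) (hm : Even m)
    (hM : m + 2 ≤ M) (x y : R) (hx : ∀ i < m, x * U i = 0) (hy : ∀ i < m, U i * y = 0) :
    x * jucysMurphy (kauffman s U) (m + 2) * y = (s ^ 2) ^ (m + 2) • (x * y) +
      (2 * (s ^ 2) ^ (m + 1)) • (x * U m * y) +
      (2 * (s ^ 2) ^ m) • (x * (U m * U (m + 1)) * y + x * (U (m + 1) * U m) * y) := by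
  have h0 : s ≠ 0 := by rintro rfl; simp at hs
  have hfar (i : ℕ) (hi : i < m) : Commute (kauffman s U (m + 1)) (U i) :=
    ((Commute.one_left _).smul_left s).add_left
      ((show Commute (U (m + 1)) (U i) from
        (hU.far i (m + 1) (by omega) (by omega)).symm).smul_left _)
  have hx' : ∀ i < m, x * kauffman s U (m + 1) * U i = 0 := fun i hi => by
    rw [mul_assoc, (hfar i hi).eq, ← mul_assoc, hx i hi, zero_mul]
  have hy' : ∀ i < m, U i * (kauffman s U (m + 1) * y) = 0 := fun i hi => by
    rw [← mul_assoc, ← (hfar i hi).eq, mul_assoc, hy i hi, mul_zero]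
  have key := compress_jucysMurphy hU hs m (by omega) _ _ hx' hy'
  have e1 (z : R) : U (m + 1) * (U (m + 1) * z) = 0 := by
    rw [← mul_assoc, hU.sq _ (by omega), zero_mul]
  have e2 (z : R) : U (m + 1) * (U m * (U (m + 1) * z)) = U (m + 1) * z := by
    rw [← mul_assoc, ← mul_assoc, hU.down m (by omega)]
  have e3 : x * jucysMurphy (kauffman s U) (m + 2) * y = x * kauffman s U (m + 1) *
      jucysMurphy (kauffman s U) (m + 1) * (kauffman s U (m + 1) * y) := by
    rw [jucysMurphy_succ]; simp only [mul_assoc]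
  rw [e3, key, if_pos hm]
  simp only [kauffman, inv_eq_of_pow_four hs, add_mul, mul_add, smul_mul_assoc, mul_smul_comm,
    one_mul, mul_one, mul_assoc, e1, e2, mul_zero, smul_zero]
  match_scalars
  all_goals first | ring1 | linear_combination (2 * (s ^ 2) ^ m * s ^ 2) * hs |
    linear_combination (2 * (s ^ 2) ^ m * s ^ 2 * (s ^ 4 - 1)) * hs |
    linear_combination (-2 * (s ^ 2) ^ m * s ^ 4) * hs |
    linear_combination (-2 * (s ^ 2) ^ m) * hs

theorem ascending_kauffman_mul {x : R} (m : ℕ) (h : ∀ i < m, U i * x = 0) :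
    ascending (kauffman s U) 0 m * x = s ^ m • x := by
  induction m with
  | zero => simp [ascending]
  | succ m ih =>
    rw [ascending, mul_assoc, zero_add, kauffman_mul_of_kill (h m (by omega)), mul_smul_comm,
      ih fun i hi => h i (by omega), smul_smul, pow_succ']

theorem ascending_kauffman_pow_mul {x : R} (m j : ℕ) (h : ∀ i < m, U i * x = 0) :
    ascending (kauffman s U) 0 m ^ j * x = s ^ (m * j) • x := by
  induction j with
  | zero => simp
  | succ j ih =>
    rw [pow_succ, mul_assoc, ascending_kauffman_mul m h, mul_smul_comm, ih, smul_smul, ← pow_add]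
    congr 2
    ring

end Kauffman

noncomputable section

namespace TL

variable {k : Type*} [Field k] {s : k}

/-! ### Braidings as braid words -/

theorem crossing_eq (N i : ℕ) (hi : i + 2 ≤ N) :
    crossing s N i = kauffman s (gen (loopValue s) N) i := by
  obtain ⟨n, rfl⟩ : ∃ n, N = n + 2 := ⟨N - 2, by omega⟩
  rw [crossing, dif_pos (by omega), kauffman, gen_eq n i (by omega), one_eq]

theorem passUnder_eq (N j m : ℕ) (h : j + m + 1 ≤ N) :
    passUnder s N j m = ascending (kauffman s (gen (loopValue s) N)) j m := by
  induction m with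
  | zero => rfl
  | succ m ih => rw [passUnder, ih (by omega), crossing_eq _ _ (by omega), comp_eq_mul, ascending]

theorem braiding_succ (N m n : ℕ) (h : n + m + 1 ≤ N) : braiding s N m (n + 1) =
    ascending (kauffman s (gen (loopValue s) N)) n m * braiding s N m n := by
  rw [braiding, passUnder_eq _ _ _ h, comp_eq_mul]

theorem braiding_one_left (N n : ℕ) (h : n + 1 ≤ N) :
    braiding s N 1 n = descending (kauffman s (gen (loopValue s) N)) 0 n := by
  induction n with
  | zero => rfl
  | succ n ih =>
    rw [braiding_succ _ _ _ (by omega), ih (by omega), descending, ascending, ascending, one_mul,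
      zero_add, add_zero]

theorem doubleBraiding_one (m : ℕ) :
    doubleBraiding s m 1 = jucysMurphy (kauffman s (gen (loopValue s) (m + 1))) m := by
  rw [doubleBraiding, braiding_one_left _ _ le_rfl, braiding_succ _ _ _ (by omega), braiding,
    one_eq, mul_one, jucysMurphy, comp_eq_mul]

theorem E_one (δ : k) : E δ 1 = 1 := by
  rw [E, if_pos (by simp)]
  exact IsJonesWenzl.jonesWenzl_eq (n := 1) rfl

theorem tensor_E_one {δ : k} {n : ℕ} (e : TL δ n n) : tensor e (E δ 1) = rightId e := by
  rw [E_one, tensor, ← one_eq, one, leftId, lift_ofTangle]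
  exact one_comp _

theorem doubleBraidingOn_E_one {n : ℕ} (e : TL (loopValue s) n n) :
    doubleBraidingOn e (E (loopValue s) 1) =
      jucysMurphy (kauffman s (gen (loopValue s) (n + 1))) n * rightId e := by
  rw [doubleBraidingOn, tensor_E_one, doubleBraiding_one, comp_eq_mul]

/-! ### The twist as a full twist -/

theorem rightId_kauffman {δ : k} (N i : ℕ) (hi : i + 2 ≤ N) :
    rightId (kauffman s (gen δ N) i) = kauffman s (gen δ (N + 1)) i := by
  rw [kauffman, map_add, map_smul, map_smul, rightId_gen N i hi, ← one_eq, rightId_one, one_eq,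
    kauffman]

theorem rightId_ascending {δ : k} (N j m : ℕ) (h : j + m + 1 ≤ N) :
    rightId (ascending (kauffman s (gen δ N)) j m) =
      ascending (kauffman s (gen δ (N + 1))) j m :=
  map_ascending (fun x : TL δ N N => (rightId x : TL δ (N + 1) (N + 1))) (rightId_one N)
    rightId_mul j m fun i hi => rightId_kauffman N i (by omega)

theorem rightId_pow {δ : k} {N : ℕ} (x : TL δ N N) (i : ℕ) : rightId (x ^ i) = rightId x ^ i := by
  induction i with
  | zero => exact rightId_one N
  | succ i ih => rw [pow_succ, rightId_mul, ih, pow_succ]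

theorem rightId_braiding (N m n : ℕ) (h : n + m ≤ N) :
    rightId (braiding s N m n) = braiding s (N + 1) m n := by
  induction n with
  | zero => exact rightId_one N
  | succ n ih =>
    rw [braiding_succ _ _ _ (by omega), rightId_mul, ih (by omega),
      rightId_ascending _ _ _ (by omega),
      braiding_succ _ _ _ (by omega)]

/-- The identity term closes to a circle, which is zero; the cup-cap term closes to a straight
strand. -/
theorem partialTrace_kauffman {δ : k} (hδ : δ = 0) (N n : ℕ) (hN : N = n + 1) :
    partialTrace (kauffman s (gen δ (N + 1)) n) = s⁻¹ • 1 := by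
  subst hN
  rw [kauffman, partialTrace_add, partialTrace_smul, partialTrace_smul, partialTrace_one,
    partialTrace_gen, hδ, zero_smul, smul_zero, zero_add]

theorem partialTraces_smul {δ : k} {m n : ℕ} (j : ℕ) (c : k) (f : TL δ (m + j) (n + j)) :
    partialTraces j (c • f) = c • partialTraces j f := by
  induction j with
  | zero => rfl
  | succ j ih => rw [partialTraces, partialTrace_smul, ih, partialTraces]

/-- Carrying a power `i` of the rotation word makes the induction close: conjugation by the last row
of the braiding shifts that power down, the last strand then meets a single crossing, and tracing it
out turns this row into one more rotation and a factor `s⁻¹`. -/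
theorem partialTraces_braiding (hs : s ^ 4 = -1) (hδ : loopValue s = 0) (n i j : ℕ) :
    partialTraces j (ascending (kauffman s (gen (loopValue s) (n + 1 + j))) j n ^ i *
      braiding s (n + 1 + j) (n + 1) j) =
    s⁻¹ ^ j • ascending (kauffman s (gen (loopValue s) (n + 1))) 0 n ^ (i + j) := by
  induction j generalizing i with
  | zero => simp only [partialTraces, braiding, one_eq, mul_one, pow_zero, one_smul, add_zero]
  | succ j ih =>
    have hU := tlRelations_gen (k := k) hδ (n + 1 + j + 1)
    have hσ := kauffman_relations hU hs
    have hc : SemiconjBy (ascending (kauffman s (gen (loopValue s) (n + 1 + j + 1))) j (n + 1))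
        (ascending (kauffman s (gen (loopValue s) (n + 1 + j + 1))) j n)
        (ascending (kauffman s (gen (loopValue s) (n + 1 + j + 1))) (j + 1) n) :=
      (ascending_mul_ascending hσ j n n le_rfl (by omega)).symm
    have e1 : ascending (kauffman s (gen (loopValue s) (n + 1 + j + 1))) (j + 1) n ^ i *
        braiding s (n + 1 + j + 1) (n + 1) (j + 1) =
        rightId (ascending (kauffman s (gen (loopValue s) (n + 1 + j))) j n) *
        kauffman s (gen (loopValue s) (n + 1 + j + 1)) (j + n) *
        rightId (ascending (kauffman s (gen (loopValue s) (n + 1 + j))) j n ^ i *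
          braiding s (n + 1 + j) (n + 1) j) := by
      rw [braiding_succ _ _ _ (by omega), ← mul_assoc, ← (hc.pow_right i).eq, rightId_mul,
        rightId_pow, rightId_ascending _ _ _ (by omega), rightId_braiding _ _ _ (by omega),
        ascending]
      simp only [mul_assoc]
    have e2 : partialTrace (kauffman s (gen (loopValue s) (n + 1 + j + 1)) (j + n)) = s⁻¹ • 1 :=
      partialTrace_kauffman hδ _ _ (by omega)
    rw [partialTraces]
    refine (congrArg (fun x => partialTraces j (partialTrace x)) e1).trans ?_
    rw [partialTrace_sandwich, e2, mul_smul_comm, mul_one, smul_mul_assoc, partialTraces_smul,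
      ← mul_assoc, ← pow_succ', ih, smul_smul, ← pow_succ', add_right_comm, add_assoc]

theorem twist_eq (hs : s ^ 4 = -1) (hδ : loopValue s = 0) (n : ℕ) : twist s (n + 1) =
    s⁻¹ ^ (n + 1) • ascending (kauffman s (gen (loopValue s) (n + 1))) 0 n ^ (n + 1) := by
  have := partialTraces_braiding hs hδ n 0 (n + 1)
  rwa [pow_zero, one_mul, zero_add] at this

/-! ### The basis morphisms in terms of the generators -/

theorem L_eq {δ : k} (hδ : δ = 0) (b : ℕ) (hk : ∀ j, 1 ≤ j → j ≤ b → (j : k) ≠ 0) :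
    L δ (2 * b + 2) = oddProjector k (gen δ (2 * b + 2)) b * gen δ (2 * b + 2) (2 * b) *
      oddProjector k (gen δ (2 * b + 2)) b := by
  rw [L, E_even hδ b hk, ← comp_assoc (cupAt δ _ _ _), ← gen_eq (2 * b) (2 * b) le_rfl, mul_assoc]
  rfl

theorem rightId_E_even {δ : k} (hδ : δ = 0) (b : ℕ) (hk : ∀ j, 1 ≤ j → j ≤ b → (j : k) ≠ 0) :
    rightId (E δ (2 * b + 2)) = oddProjector k (gen δ (2 * b + 3)) b := by
  rw [E_even hδ b hk, rightId_oddProjector _ _ (by omega)]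

theorem E_odd_comp_cap {δ : k} (hδ : δ = 0) (b : ℕ) (hk : ∀ j, 1 ≤ j → j ≤ b → (j : k) ≠ 0) :
    E δ (2 * b + 1) ⊚ capAt δ (2 * b + 1) (2 * b + 1) le_rfl =
      capAt δ (2 * b + 1) (2 * b + 1) le_rfl ⊚ oddProjector k (gen δ (2 * b + 3)) b := by
  rw [E_odd hδ b hk, ← cap_comp_rightId, rightId_oddProjector _ _ (by omega),
    rightId_oddProjector _ _ (by omega)]

theorem oddProjector_gen_idem {δ : k} (hδ : δ = 0) (b : ℕ)
    (hk : ∀ j, 1 ≤ j → j ≤ b → (j : k) ≠ 0) (N : ℕ) (hN : 2 * b + 1 ≤ N) :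
    oddProjector k (gen δ N) b * oddProjector k (gen δ N) b = oddProjector k (gen δ N) b :=
  oddProjector_mul_oddProjector (tlRelations_gen hδ N) le_rfl (by omega) hk

theorem A_eq {δ : k} (hδ : δ = 0) (b : ℕ) (hk : ∀ j, 1 ≤ j → j ≤ b → (j : k) ≠ 0) :
    A δ (2 * b + 3) = oddProjector k (gen δ (2 * b + 3)) b *
      (gen δ (2 * b + 3) (2 * b) * gen δ (2 * b + 3) (2 * b + 1)) *
        oddProjector k (gen δ (2 * b + 3)) b := by
  -- The middle projector slides through the cap and is absorbed by the outer one.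
  rw [A, rightId_E_even hδ b hk, ← comp_assoc (E δ _), E_odd_comp_cap hδ b hk, comp_assoc,
    comp_eq_mul (oddProjector k (gen δ (2 * b + 3)) b) (oddProjector k (gen δ (2 * b + 3)) b),
    oddProjector_gen_idem hδ b hk _ (by omega), ← comp_assoc (cupAt δ _ _ _),
    cup_cap_succ (2 * b + 1) (2 * b) le_rfl, mul_assoc]
  rfl

/-- The cap at `2b` is the cap at `2b + 1` composed with the generator `U_{2b}`; in this form the
projector can slide to the right of it. -/
theorem E_odd_comp_cap' {δ : k} (hδ : δ = 0) (b : ℕ) (hk : ∀ j, 1 ≤ j → j ≤ b → (j : k) ≠ 0) :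
    E δ (2 * b + 1) ⊚ capAt δ (2 * b + 1) (2 * b) (by omega) =
      capAt δ (2 * b + 1) (2 * b + 1) le_rfl ⊚ (oddProjector k (gen δ (2 * b + 3)) b *
        gen δ (2 * b + 3) (2 * b)) := by
  rw [gen_eq (2 * b + 1) (2 * b) (by omega), ← comp_eq_mul, ← comp_assoc, ← comp_assoc,
    ← E_odd_comp_cap hδ b hk, comp_assoc (E δ _), cap_succ_cup (2 * b + 1) (2 * b) le_rfl, comp_one]

theorem Atilde_eq {δ : k} (hδ : δ = 0) (b : ℕ) (hk : ∀ j, 1 ≤ j → j ≤ b → (j : k) ≠ 0) :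
    Atilde δ (2 * b + 3) = oddProjector k (gen δ (2 * b + 3)) b *
      (gen δ (2 * b + 3) (2 * b + 1) * gen δ (2 * b + 3) (2 * b)) *
        oddProjector k (gen δ (2 * b + 3)) b := by
  have hc : gen δ (2 * b + 3) (2 * b + 1) * oddProjector k (gen δ (2 * b + 3)) b =
      oddProjector k (gen δ (2 * b + 3)) b * gen δ (2 * b + 3) (2 * b + 1) :=
    (oddProjector_commute b fun i hi =>
      (tlRelations_gen hδ (2 * b + 3)).far i _ (by omega) (by omega)).symm
  rw [Atilde, rightId_E_even hδ b hk, ← comp_assoc (E δ _), E_odd_comp_cap' hδ b hk,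
    ← comp_assoc (cupAt δ _ _ _), ← comp_assoc (cupAt δ _ _ _),
    ← gen_eq (2 * b + 1) (2 * b + 1) le_rfl]
  change oddProjector k (gen δ (2 * b + 3)) b * (gen δ (2 * b + 3) (2 * b + 1) *
    (oddProjector k (gen δ (2 * b + 3)) b * gen δ (2 * b + 3) (2 * b)) *
      oddProjector k (gen δ (2 * b + 3)) b) = _
  rw [← mul_assoc (gen δ _ _), hc]
  simp only [← mul_assoc, oddProjector_gen_idem hδ b hk (2 * b + 3) (by omega)]

theorem Y_eq {δ : k} (hδ : δ = 0) (b : ℕ) (hk : ∀ j, 1 ≤ j → j ≤ b + 1 → (j : k) ≠ 0) :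
    Y δ (2 * b + 3) = oddProjector k (gen δ (2 * b + 3)) b * gen δ (2 * b + 3) (2 * b) *
        oddProjector k (gen δ (2 * b + 3)) b := by
  have hk' : ∀ j, 1 ≤ j → j ≤ b → (j : k) ≠ 0 := fun j h h' => hk j h (by omega)
  rw [Y, rightId_E_even hδ b hk', ← comp_assoc (E δ _), E_odd_comp_cap' hδ b hk',
    ← comp_assoc (cupAt δ _ _ _), ← comp_assoc (cupAt δ _ _ _),
    cup_cap_succ (2 * b + 1) (2 * b) le_rfl,
    -- Here the middle projector is not absorbed: the left side is the word `f u v f u f`, and the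
    -- sandwich identity collapses it to `f u f`.
    ← oddProjector_sandwich (tlRelations_gen hδ (2 * b + 3)) b (by omega) hk]
  change oddProjector k (gen δ (2 * b + 3)) b * (gen δ (2 * b + 3) (2 * b) *
    gen δ (2 * b + 3) (2 * b + 1) * (oddProjector k (gen δ (2 * b + 3)) b *
      gen δ (2 * b + 3) (2 * b)) * oddProjector k (gen δ (2 * b + 3)) b) = _
  simp only [mul_assoc]

theorem B_eq {δ : k} (hδ : δ = 0) (b : ℕ) (hb : 1 ≤ b)
    (hk : ∀ j, 1 ≤ j → j ≤ b → (j : k) ≠ 0) :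
    B δ (2 * b + 3) = -((b : k) / (b + 1)) • (oddProjector k (gen δ (2 * b + 3)) b *
      (gen δ (2 * b + 3) (2 * b) * gen δ (2 * b + 3) (2 * b - 1) *
        gen δ (2 * b + 3) (2 * b + 1) * gen δ (2 * b + 3) (2 * b)) *
        oddProjector k (gen δ (2 * b + 3)) b) := by
  obtain ⟨d, rfl⟩ : ∃ d, b = d + 1 := ⟨b - 1, by omega⟩
  have hk' : ∀ j, 1 ≤ j → j ≤ d → (j : k) ≠ 0 := fun j h h' => hk j h (by omega)
  -- Both nested caps are crossed by sliding, so that the small projector reaches the larger one and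
  -- disappears into it.
  have e1 : E δ (2 * d + 1) ⊚ capAt δ (2 * d + 1) (2 * d + 1) le_rfl ⊚
      capAt δ (2 * d + 1 + 2) (2 * d + 1 + 1) (by omega) =
      (capAt δ (2 * d + 1) (2 * d + 1) le_rfl ⊚
        capAt δ (2 * d + 1 + 2) (2 * d + 1 + 1) (by omega)) ⊚
        oddProjector k (gen δ (2 * d + 1 + 4)) d := by
    have := congrArg rightId (cap_comp_rightId (oddProjector k (gen δ (2 * d + 2)) d))
    rw [rightId_comp, rightId_comp, rightId_capAt, rightId_oddProjector _ _ (by omega),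
      rightId_oddProjector _ _ (by omega), rightId_oddProjector _ _ (by omega)] at this
    rw [← comp_assoc, E_odd_comp_cap hδ d hk', comp_assoc, comp_assoc]
    exact congrArg (_ ⊚ ·) this.symm
  have e2 : oddProjector k (gen δ (2 * d + 1 + 4)) d *
      oddProjector k (gen δ (2 * d + 1 + 4)) (d + 1) =
      oddProjector k (gen δ (2 * d + 1 + 4)) (d + 1) :=
    oddProjector_mul_oddProjector (tlRelations_gen hδ _) (by omega) (by omega) hk
  have e3 : rightIds (E δ (2 * d + 1 + 2)) 2 =
      oddProjector k (gen δ (2 * d + 1 + 4)) (d + 1) := by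
    change rightId (rightId (E δ (2 * d + 1 + 2))) = _
    have h := E_odd hδ (d + 1) hk
    rw [show 2 * (d + 1) + 1 = 2 * d + 1 + 2 by ring] at h
    rw [h, rightId_oddProjector _ _ (by omega), rightId_oddProjector _ _ (by omega)]
  have e4 : E δ (2 * d + 1) ⊚ capAt δ (2 * d + 1) (2 * d + 1) le_rfl ⊚
      capAt δ (2 * d + 1 + 2) (2 * d + 1 + 1) (by omega) ⊚
        oddProjector k (gen δ (2 * d + 1 + 4)) (d + 1) =
      capAt δ (2 * d + 1) (2 * d + 1) le_rfl ⊚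
        capAt δ (2 * d + 1 + 2) (2 * d + 1 + 1) (by omega) ⊚
          oddProjector k (gen δ (2 * d + 1 + 4)) (d + 1) := by
    have := congrArg (· ⊚ oddProjector k (gen δ (2 * d + 1 + 4)) (d + 1)) e1
    beta_reduce at this
    rw [comp_assoc _ (oddProjector k (gen δ (2 * d + 1 + 4)) d), comp_eq_mul (oddProjector _ _ d),
      e2] at this
    simpa only [comp_assoc] using this
  have e5 := congrArg (oddProjector k (gen δ (2 * d + 1 + 4)) (d + 1) ⊚ · ⊚
    oddProjector k (gen δ (2 * d + 1 + 4)) (d + 1)) (cup_cup_cap_cap (δ := δ) (2 * d + 1))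
  simp only [comp_assoc] at e5
  change B δ (2 * d + 1 + 4) = _
  rw [B, e3, e4, e5, show (2 * d + 1 + 4) / 2 = d + 2 by omega]
  congr 1
  · push_cast
    ring
  · exact (mul_assoc _ _ _).symm

theorem loopValue_eq_zero (hs : s ^ 4 = -1) : loopValue s = 0 := by
  have h0 : s ≠ 0 := by rintro rfl; simp at hs
  rw [loopValue]
  field_simp
  linear_combination -hs

/-- The loop of a strand around the others commutes with a projector on the strands that it
encircles. -/
theorem jucysMurphy_mul_oddProjector (hs : s ^ 4 = -1) (b m N : ℕ) (hb : 2 * b < m)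
    (hN : m + 1 ≤ N) (hk : ∀ j, 1 ≤ j → j ≤ b → (j : k) ≠ 0) :
    jucysMurphy (kauffman s (gen (loopValue s) N)) m * oddProjector k (gen (loopValue s) N) b =
      oddProjector k (gen (loopValue s) N) b *
        jucysMurphy (kauffman s (gen (loopValue s) N)) m *
          oddProjector k (gen (loopValue s) N) b := by
  have hδ := loopValue_eq_zero hs
  have hc : Commute (oddProjector k (gen (loopValue s) N) b)
      (jucysMurphy (kauffman s (gen (loopValue s) N)) m) :=
    oddProjector_commute b fun i hi =>
      jucysMurphy_commute_gen (tlRelations_gen hδ N) hs i m (by omega) (by omega)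
  rw [hc.eq, mul_assoc, oddProjector_gen_idem hδ b hk N (by omega)]

/-! ### Double braidings and twists -/

theorem doubleBraidingOn_odd (hs : s ^ 4 = -1) (b : ℕ)
    (hk : ∀ j, 1 ≤ j → j ≤ b → (j : k) ≠ 0) :
    doubleBraidingOn (E (loopValue s) (2 * b + 1)) (E (loopValue s) 1) =
      (s ^ 2) ^ (2 * b + 1) • E (loopValue s) (2 * b + 2) +
        (2 * (s ^ 2) ^ (2 * b)) • L (loopValue s) (2 * b + 2) := by
  have hδ := loopValue_eq_zero hs
  have hU := tlRelations_gen hδ (2 * b + 2)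
  rw [doubleBraidingOn_E_one, E_odd hδ b hk, rightId_oddProjector _ _ le_rfl,
    jucysMurphy_mul_oddProjector hs b _ _ (by omega) (by omega) hk,
    compress_jucysMurphy hU hs (2 * b) (by omega) _ _
      (oddProjector_mul_gen hU b (by omega) hk) (gen_mul_oddProjector hU b (by omega) hk),
    if_pos (by simp), oddProjector_gen_idem hδ b hk _ (by omega), E_even hδ b hk, L_eq hδ b hk]

theorem doubleBraidingOn_even (hs : s ^ 4 = -1) (b : ℕ)
    (hk : ∀ j, 1 ≤ j → j ≤ b + 1 → (j : k) ≠ 0) :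
    doubleBraidingOn (E (loopValue s) (2 * b + 2)) (E (loopValue s) 1) =
      (s ^ 2) ^ (2 * b + 2) • E (loopValue s) (2 * b + 3) +
        (s ^ 2) ^ (2 * b) • A (loopValue s) (2 * b + 3) +
        (s ^ 2) ^ (2 * b) • Atilde (loopValue s) (2 * b + 3) +
        (2 * (s ^ 2) ^ (2 * b + 1)) • Y (loopValue s) (2 * b + 3) +
        (if b = 0 then 0 else (s ^ 2) ^ (2 * b + 2) • B (loopValue s) (2 * b + 3)) := by
  have hδ := loopValue_eq_zero hs
  have hU := tlRelations_gen hδ (2 * b + 3)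
  have hk' : ∀ j, 1 ≤ j → j ≤ b → (j : k) ≠ 0 := fun j h h' => hk j h (by omega)
  have hE : E (loopValue s) (2 * b + 3) =
      oddProjector k (gen (loopValue s) (2 * b + 3)) (b + 1) := E_odd hδ (b + 1) hk
  rw [doubleBraidingOn_E_one, rightId_E_even hδ b hk',
    jucysMurphy_mul_oddProjector hs b _ _ (by omega) (by omega) hk',
    compress_jucysMurphy_succ hU hs (2 * b) (by simp) (by omega) _ _
      (oddProjector_mul_gen hU b (by omega) hk') (gen_mul_oddProjector hU b (by omega) hk'),
    oddProjector_gen_idem hδ b hk' _ (by omega), hE, A_eq hδ b hk', Atilde_eq hδ b hk',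
    Y_eq hδ b hk, oddProjector]
  -- Substituting the recursion for `E_v`, the term with `b/(b+1)` cancels against `B` (it is absent
  -- for `b = 0`). As `ζ^(2b+2) = -ζ^(2b)`, the terms `-A` and `-Ã` inside `E_v` supply half of the
  -- coefficient `2ζ^(2b)`.
  split_ifs with hb
  · subst hb
    simp only [Nat.cast_zero, zero_div, zero_smul, add_zero]
    match_scalars <;> first | ring1 | linear_combination (s ^ 2) ^ (2 * 0) * hs
  · rw [B_eq hδ b (by omega) hk']
    match_scalars <;> first | ring1 | linear_combination (s ^ 2) ^ (2 * b) * hs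

theorem twistOn_odd (hs : s ^ 4 = -1) (b : ℕ) (hk : ∀ j, 1 ≤ j → j ≤ b → (j : k) ≠ 0) :
    twistOn (E (loopValue s) (2 * b + 1)) =
      (s⁻¹ ^ (2 * b + 1) * s ^ (2 * b * (2 * b + 1))) • E (loopValue s) (2 * b + 1) := by
  have hδ := loopValue_eq_zero hs
  have hU := tlRelations_gen hδ (2 * b + 1)
  rw [twistOn, twist_eq hs hδ, E_odd hδ b hk, comp_eq_mul, smul_mul_assoc,
    ascending_kauffman_pow_mul _ _ (gen_mul_oddProjector hU b (by omega) hk), smul_smul]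

theorem twistOn_even (hs : s ^ 4 = -1) (b : ℕ) (hk : ∀ j, 1 ≤ j → j ≤ b → (j : k) ≠ 0) :
    twistOn (E (loopValue s) (2 * b + 2)) =
      E (loopValue s) (2 * b + 2) + (2 * (s ^ 2)⁻¹) • L (loopValue s) (2 * b + 2) := by
  have h0 : s ≠ 0 := by rintro rfl; simp at hs
  have hδ := loopValue_eq_zero hs
  have hU := tlRelations_gen hδ (2 * b + 2)
  -- The total exponent of `s` is `4b(b+1)`, and `b(b+1)` is even, so the framing factor, the full
  -- twist on the first `2b + 1` strands and the leading Jucys-Murphy scalar multiply to `1`.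
  have h1 : s⁻¹ ^ (2 * b + 1 + 1) * s ^ (2 * b * (2 * b + 1)) * (s ^ 2) ^ (2 * b + 1) = 1 := by
    have h : s ^ (2 * b * (2 * b + 1)) * (s ^ 2) ^ (2 * b + 1) =
        s ^ (2 * b + 1 + 1) * (s ^ 4) ^ (b * (b + 1)) := by
      simp only [← pow_mul, ← pow_add]
      congr 1
      ring
    rw [mul_assoc, h, hs, Even.neg_one_pow (Nat.even_mul_succ_self b), mul_one, ← mul_pow,
      inv_mul_cancel₀ h0, one_pow]
  have h2 : s⁻¹ ^ (2 * b + 1 + 1) * s ^ (2 * b * (2 * b + 1)) * (2 * (s ^ 2) ^ (2 * b)) =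
      2 * (s ^ 2)⁻¹ := by
    rw [eq_mul_inv_iff_mul_eq₀ (pow_ne_zero 2 h0)]
    linear_combination 2 * h1
  have h3 := fullTwist_eq (kauffman_relations hU hs) (2 * b) (by omega)
  rw [twistOn, twist_eq hs hδ, h3, E_even hδ b hk, comp_eq_mul, smul_mul_assoc, mul_assoc,
    jucysMurphy_mul_oddProjector hs b _ _ (by omega) (by omega) hk, mul_assoc, ← mul_assoc,
    ascending_kauffman_pow_mul _ _ (gen_mul_oddProjector hU b (by omega) hk), smul_mul_assoc,
    ← mul_assoc, compress_jucysMurphy hU hs (2 * b) (by omega) _ _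
      (oddProjector_mul_gen hU b (by omega) hk) (gen_mul_oddProjector hU b (by omega) hk),
    if_pos (by simp), oddProjector_gen_idem hδ b hk _ (by omega), L_eq hδ b hk, smul_add, smul_add,
    smul_smul, smul_smul, smul_smul, smul_smul, h1, h2, one_smul]

end TL

end

/-! ### Assembly of the double braiding and twist formulas -/

theorem mainTheorem9 {k : Type*} [Field k] [IsAlgClosed k] (p : ℕ) [Fact p.Prime] [CharP k p]
    (s ζ : k) (hs : s ^ 2 = ζ) (hζ : IsPrimitiveRoot ζ 4)
    (n a₁ : ℕ) (ha₁ : 1 ≤ a₁) (ha₁p : a₁ ≤ p - 1) :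
    -- `v = n + 1 = [a₁, 0]`
    (n + 1 = 2 * a₁ →
      TL.toVer p (TL.doubleBraidingOn (TL.E (TL.loopValue s) n) (TL.E (TL.loopValue s) 1)) =
        TL.toVer p (ζ ^ n • TL.E (TL.loopValue s) (n + 1)
          + (2 * ζ ^ ((n : ℤ) - 1)) • TL.L (TL.loopValue s) (n + 1)) ∧
      TL.toVer p (TL.twistOn (TL.E (TL.loopValue s) n)) =
        TL.toVer p (s ^ ((n : ℤ) * ((n : ℤ) - 2)) • TL.E (TL.loopValue s) n) ∧
      s ^ ((n : ℤ) * ((n : ℤ) - 2)) = s ^ (4 * (a₁ : ℤ) ^ 2 - 8 * (a₁ : ℤ) + 3) ∧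
      s ^ (4 * (a₁ : ℤ) ^ 2 - 8 * (a₁ : ℤ) + 3) = (-1) ^ a₁ * s ^ 3) ∧
    -- `v = n + 1 = [a₁, 1]`
    (n + 1 = 2 * a₁ + 1 →
      TL.toVer p (TL.doubleBraidingOn (TL.E (TL.loopValue s) n) (TL.E (TL.loopValue s) 1)) =
        TL.toVer p ((if a₁ = p - 1 then 0 else ζ ^ n • TL.E (TL.loopValue s) (n + 1))
          + ζ ^ ((n : ℤ) - 2) • TL.A (TL.loopValue s) (n + 1)
          + ζ ^ ((n : ℤ) - 2) • TL.Atilde (TL.loopValue s) (n + 1)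
          + (2 * ζ ^ ((n : ℤ) - 1)) • TL.Y (TL.loopValue s) (n + 1)
          + (if a₁ = 1 then 0 else ζ ^ n • TL.B (TL.loopValue s) (n + 1))) ∧
      TL.toVer p (TL.twistOn (TL.E (TL.loopValue s) n)) =
        TL.toVer p (TL.E (TL.loopValue s) n + (2 * ζ⁻¹) • TL.L (TL.loopValue s) n)) := by
  subst hs
  have hs4 : s ^ 4 = -1 := by
    have h : (s ^ 2) ^ 2 = -1 :=
      (hζ.pow (by norm_num) (show 4 = 2 * 2 by norm_num)).eq_neg_one_of_two_right
    rw [← h]; ring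
  have h0 : s ≠ 0 := by rintro rfl; simp at hs4
  -- The bound `a₁ ≤ p - 1` enters here: all denominators in the projectors are invertible.
  have hk : ∀ j, 1 ≤ j → j ≤ a₁ → (j : k) ≠ 0 := fun j hj hj' h => by
    have := Nat.le_of_dvd hj ((CharP.cast_eq_zero_iff k p j).1 h)
    have := (Fact.out : p.Prime).two_le
    omega
  obtain ⟨b, rfl⟩ : ∃ b, a₁ = b + 1 := ⟨a₁ - 1, by omega⟩
  have hk' : ∀ j, 1 ≤ j → j ≤ b → (j : k) ≠ 0 := fun j h h' => hk j h (by omega)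
  constructor
  · intro hn
    obtain rfl : n = 2 * b + 1 := by omega
    refine ⟨?_, ?_, ?_, ?_⟩
    · rw [TL.doubleBraidingOn_odd hs4 b hk',
        show ((2 * b + 1 : ℕ) : ℤ) - 1 = ((2 * b : ℕ) : ℤ) by push_cast; ring, zpow_natCast]
    · rw [TL.twistOn_odd hs4 b hk']
      congr 2
      rw [inv_pow, ← zpow_natCast, ← zpow_neg, ← zpow_natCast, ← zpow_add₀ h0]
      congr 1
      push_cast
      ring
    · congr 1
      push_cast
      ring
    · have h : s ^ (4 * ((b + 1 : ℕ) : ℤ) ^ 2 - 8 * ((b + 1 : ℕ) : ℤ) + 3) =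
          (s ^ 4) ^ (((b : ℤ) + 1) ^ 2 - 2 * ((b : ℤ) + 1)) * s ^ 3 := by
        rw [← zpow_natCast s 4, ← zpow_mul, ← zpow_natCast s 3, ← zpow_add₀ h0]
        congr 1
        push_cast
        ring
      rw [h, hs4]
      congr 1
      -- With `b(b - 1) = 2c`, the exponent `(b+1)² - 2(b+1) = b² - 1` equals `(b + 1) + 2(c - 1)`,
      -- so it has the parity of `a₁ = b + 1`.
      obtain ⟨c, hc⟩ := Int.even_mul_pred_self (b : ℤ)
      rw [show ((b : ℤ) + 1) ^ 2 - 2 * (b + 1) = ((b + 1 : ℕ) : ℤ) + 2 * (c - 1) by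
        push_cast; linear_combination hc, zpow_add₀ (by norm_num), zpow_mul, zpow_natCast]
      norm_num
  · intro hn
    obtain rfl : n = 2 * b + 2 := by omega
    refine ⟨?_, ?_⟩
    · rw [TL.doubleBraidingOn_even hs4 b hk,
        show ((2 * b + 2 : ℕ) : ℤ) - 1 = ((2 * b + 1 : ℕ) : ℤ) by push_cast; ring,
        show ((2 * b + 2 : ℕ) : ℤ) - 2 = ((2 * b : ℕ) : ℤ) by push_cast; ring, zpow_natCast,
        zpow_natCast]
      simp only [add_eq_right (b := 1)]
      -- For `v = 2p - 1` the identity computed in the category still contains `E_v`; this term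
      -- vanishes only in the quotient.
      by_cases hp : b + 1 = p - 1
      · rw [if_pos hp, zero_add]
        simp only [map_add, map_smul]
        rw [TL.toVer_E_eq_zero (TL.loopValue_eq_zero hs4) b (by omega) hk, smul_zero, zero_add]
      · rw [if_neg hp]
    · rw [TL.twistOn_even hs4 b hk']
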